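/- **Setting.** Let $1\le K$ and $n<p$ be integers. Consider the factor regression model $$X=AZ+E,\qquad y=Z^\top\beta+\varepsilon ,$$ with $A\in\mathbb R^{p\times K}$, $\beta\in\mathbb R^K$ deterministic, and $Z\in\mathbb R^K$, $E\in\mathbb R^p$, $\varepsilon\in\mathbb R$ mutually independent with mean zero and finite second moments. Write $\Sigma_Z,\Sigma_E,\Sigma_X$ for the covariance matrices of $Z,E,X$, $\Sigma_{Xy}=\mathbb E[Xy]$, $\sigma_\varepsilon^2=\mathrm{Var}(\varepsilon)$. Let $\lambda_1(Q)\ge\lambda_2(Q)\ge\cdots$ be the ordered eigenvalues of a symmetric matrix $Q$, $\|Q\|$ its operator norm, $B^+$ the Moore–Penrose pseudo-inverse of $B$, $\|v\|$ the Euclidean norm and $\|v\|_Q^2=v^\top Qv$. Put $$R(\alpha)=\mathbb E[(X^\top\alpha-y)^2],\qquad \alpha^*=\Sigma_X^+\Sigma_{Xy},\qquad \xi=\frac{\lambda_K(A\Sigma_ZA^\top)}{\|\Sigma_E\|},\qquad \kappa(\Sigma_E)=\frac{\lambda_1(\Sigma_E)}{\lambda_p(\Sigma_E)},$$ with $\xi^{-1}=0$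 if $\Sigma_E=0$. Let $(Z_i,E_i,\varepsilon_i)$, $i=1,\dots,n$, be i.i.d. copies of $(Z,E,\varepsilon)$, let $\mathbf X\in\mathbb R^{n\times p}$ have rows $X_i=AZ_i+E_i$ and let $\mathbf y\in\mathbb R^n$ have entries $y_i=Z_i^\top\beta+\varepsilon_i$. Let the columns of $U_K\in\mathbb R^{p\times K}$ be (any choice of) orthonormal eigenvectors of $\Sigma_X$ for its $K$ largest eigenvalues, and let $$\widetilde\alpha_{\rm PCR}=U_K(\mathbf XU_K)^+\mathbf y .$$ The risk $R(\widetilde\alpha_{\rm PCR})$ is the function $R$ evaluated at the (random) vector $\widetilde\alpha_{\rm PCR}$, that is, the expectation is over a new data point independent of the sample. **Theorem.** There are absolute constants $C,c,C'>0$ such that the following holds. Suppose that $(X,y)$ is jointly Gaussian, that $A$ and $\Sigma_Z$ both have rank $K$, and that $n>C\,K\log n$. Then, with probability at least $1-c/n$ over the sample, all of the following hold: 1. $\displaystyle R(\widetilde\alpha_{\rm PCR})-R(\alpha^*)\le C'\Big(\|\Sigma_E\|\,\|\alpha^*\|^2\,\frac pn+R(\alpha^*)\,\frac{K\log n}{n}\Big)$;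 2. $\displaystyle R(\widetilde\alpha_{\rm PCR})-\sigma_\varepsilon^2\le C'\Big(\big(1+\xi^{-1}\big)\|\Sigma_E\|\,\|\alpha^*\|^2\,\frac pn+R(\alpha^*)\,\frac{K\log n}{n}\Big)$ (so that, whenever $\xi$ is bounded below by a positive constant, the bound in 1 holds, up to a constant, also for the excess over $\sigma_\varepsilon^2$); 3. if $\Sigma_E=0$, then $\displaystyle R(\widetilde\alpha_{\rm PCR})-\sigma_\varepsilon^2\le C'\,\sigma_\varepsilon^2\,\frac{K\log n}{n}$; 4. if $\lambda_p(\Sigma_E)>0$, then $\displaystyle R(\widetilde\alpha_{\rm PCR})-\sigma_\varepsilon^2\le C'\Big(\kappa(\Sigma_E)\,\frac{\|\beta\|_{\Sigma_Z}^2}{\xi}\,\frac pn+\sigma_\varepsilon^2\,\frac{K\log n}{n}\Big)$. -/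

import Mathlib

open MeasureTheory ProbabilityTheory
open scoped Matrix ENNReal

noncomputable section

/-! ### Linear algebra: Moore–Penrose inverse, ordered eigenvalues, operator norm -/

/-- The four Penrose conditions: `C` is a Moore–Penrose pseudo-inverse of `B`. -/
structure IsMoorePenrose {n m : ℕ} (B : Matrix (Fin n) (Fin m) ℝ)
    (C : Matrix (Fin m) (Fin n) ℝ) : Prop where
  mul_mul_self : B * C * B = B
  mul_mul_inv : C * B * C = C
  symm_left : (B * C)ᵀ = B * C
  symm_right : (C * B)ᵀ = C * B

theorem exists_symm_pinv {m : ℕ} (G : Matrix (Fin m) (Fin m) ℝ) (hG : G.IsHermitian) :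
    ∃ P : Matrix (Fin m) (Fin m) ℝ,
      Pᵀ = P ∧ G * P * G = G ∧ P * G * P = P ∧ (P * G)ᵀ = P * G := by
  obtain ⟨U, l, hUU, hGs⟩ : ∃ (U : Matrix (Fin m) (Fin m) ℝ) (l : Fin m → ℝ),
      Uᵀ * U = 1 ∧ G = U * Matrix.diagonal l * Uᵀ := by
    refine ⟨(hG.eigenvectorUnitary : Matrix (Fin m) (Fin m) ℝ), hG.eigenvalues, ?_, ?_⟩
    · have h := Unitary.coe_star_mul_self hG.eigenvectorUnitary
      rw [Matrix.star_eq_conjTranspose, Matrix.conjTranspose_eq_transpose_of_trivial] at h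
      exact h
    · have h := hG.spectral_theorem
      rw [Unitary.conjStarAlgAut_apply, Matrix.star_eq_conjTranspose,
        Matrix.conjTranspose_eq_transpose_of_trivial] at h
      exact h
  have key : ∀ d e : Fin m → ℝ, (U * Matrix.diagonal d * Uᵀ) * (U * Matrix.diagonal e * Uᵀ)
      = U * Matrix.diagonal (fun i => d i * e i) * Uᵀ := by
    intro d e
    calc (U * Matrix.diagonal d * Uᵀ) * (U * Matrix.diagonal e * Uᵀ)
        = U * Matrix.diagonal d * (Uᵀ * U) * Matrix.diagonal e * Uᵀ := by
          simp only [Matrix.mul_assoc]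
      _ = U * Matrix.diagonal (fun i => d i * e i) * Uᵀ := by
          rw [hUU, Matrix.mul_one, Matrix.mul_assoc U, Matrix.diagonal_mul_diagonal]
  have hsym : ∀ d : Fin m → ℝ, (U * Matrix.diagonal d * Uᵀ)ᵀ = U * Matrix.diagonal d * Uᵀ := by
    intro d
    simp [Matrix.transpose_mul, Matrix.mul_assoc]
  refine ⟨U * Matrix.diagonal (fun i => (l i)⁻¹) * Uᵀ, hsym _, ?_, ?_, ?_⟩
  · rw [hGs, key, key]
    congr 3
    funext i
    exact mul_inv_mul_cancel _
  · rw [hGs, key, key]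
    congr 3
    funext i
    by_cases h : l i = 0
    · simp [h]
    · field_simp
  · rw [hGs, key, hsym]

theorem exists_isMoorePenrose {n m : ℕ} (B : Matrix (Fin n) (Fin m) ℝ) :
    ∃ C, IsMoorePenrose B C := by
  have hG : (Bᵀ * B).IsHermitian := by
    have h := Matrix.isHermitian_conjTranspose_mul_self B
    rwa [Matrix.conjTranspose_eq_transpose_of_trivial] at h
  obtain ⟨P, hP, h1, h2, h3⟩ := exists_symm_pinv (Bᵀ * B) hG
  have h0 : B * (P * (Bᵀ * B) - 1) = 0 := by
    have h : Bᵀ * B * (P * (Bᵀ * B) - 1) = 0 := by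
      rw [Matrix.mul_sub, Matrix.mul_one, ← Matrix.mul_assoc (Bᵀ * B) P, h1, sub_self]
    have h' := (Matrix.conjTranspose_mul_self_mul_eq_zero B (P * (Bᵀ * B) - 1)).1
    rw [Matrix.conjTranspose_eq_transpose_of_trivial] at h'
    exact h' h
  refine ⟨P * Bᵀ, ?_, ?_, ?_, ?_⟩
  · rw [Matrix.mul_sub, Matrix.mul_one, sub_eq_zero] at h0
    simpa only [Matrix.mul_assoc] using h0
  · calc P * Bᵀ * B * (P * Bᵀ) = P * (Bᵀ * B) * P * Bᵀ := by simp only [Matrix.mul_assoc]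
      _ = P * Bᵀ := by rw [h2]
  · simp [Matrix.transpose_mul, hP, Matrix.mul_assoc]
  · simpa only [Matrix.mul_assoc] using h3

/-- The Penrose conditions determine the pseudo-inverse uniquely. -/
theorem IsMoorePenrose.unique {n m : ℕ} {B : Matrix (Fin n) (Fin m) ℝ}
    {C D : Matrix (Fin m) (Fin n) ℝ} (hC : IsMoorePenrose B C) (hD : IsMoorePenrose B D) :
    C = D := by
  have hL : B * C = B * D := by
    calc B * C = (B * C)ᵀ := hC.symm_left.symm
      _ = (B * D * (B * C))ᵀ := by rw [← Matrix.mul_assoc, hD.mul_mul_self]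
      _ = B * C * (B * D) := by rw [Matrix.transpose_mul, hC.symm_left, hD.symm_left]
      _ = B * D := by rw [← Matrix.mul_assoc, hC.mul_mul_self]
  have hR : C * B = D * B := by
    calc C * B = (C * B)ᵀ := hC.symm_right.symm
      _ = (C * B * (D * B))ᵀ := by
          rw [Matrix.mul_assoc, ← Matrix.mul_assoc B, hD.mul_mul_self]
      _ = D * B * (C * B) := by rw [Matrix.transpose_mul, hC.symm_right, hD.symm_right]
      _ = D * B := by rw [Matrix.mul_assoc, ← Matrix.mul_assoc B, hC.mul_mul_self]
  calc C = C * B * C := hC.mul_mul_inv.symm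
    _ = D * (B * C) := by rw [hR, Matrix.mul_assoc]
    _ = D := by rw [hL, ← Matrix.mul_assoc, hD.mul_mul_inv]

/-- The Moore–Penrose pseudo-inverse `B⁺`. -/
def pinv {n m : ℕ} (B : Matrix (Fin n) (Fin m) ℝ) : Matrix (Fin m) (Fin n) ℝ :=
  Classical.choose (exists_isMoorePenrose B)

theorem isMoorePenrose_pinv {n m : ℕ} (B : Matrix (Fin n) (Fin m) ℝ) :
    IsMoorePenrose B (pinv B) :=
  Classical.choose_spec (exists_isMoorePenrose B)

/-- The `k`-th largest eigenvalue `λ_k(Q)`, `1 ≤ k ≤ d`, of a symmetric `d × d` matrix, counted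
with multiplicity. (The value is `0` for other `k` or if `Q` is not symmetric.) -/
def ordEig {d : ℕ} (Q : Matrix (Fin d) (Fin d) ℝ) (k : ℕ) : ℝ :=
  if h : Q.IsHermitian ∧ 1 ≤ k ∧ k ≤ d then
    h.1.eigenvalues₀ ⟨k - 1, by rw [Fintype.card_fin]; omega⟩
  else 0

/-- The operator norm of a square matrix with respect to the Euclidean norm. -/
def opNorm {d : ℕ} (Q : Matrix (Fin d) (Fin d) ℝ) : ℝ :=
  ‖Matrix.toEuclideanCLM (𝕜 := ℝ) Q‖

/-- The condition number `λ₁(Q) / λ_d(Q)`. -/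
def condNumber {d : ℕ} (Q : Matrix (Fin d) (Fin d) ℝ) : ℝ :=
  ordEig Q 1 / ordEig Q d

/-- The squared weighted norm `‖v‖²_Q = vᵀ Q v`. -/
def wNormSq {d : ℕ} (Q : Matrix (Fin d) (Fin d) ℝ) (v : Fin d → ℝ) : ℝ :=
  v ⬝ᵥ (Q *ᵥ v)

/-- The columns of `U` are orthonormal eigenvectors of `Q` for its `K` largest eigenvalues, in
decreasing order. -/
structure IsTopEigenvectors {p K : ℕ} (Q : Matrix (Fin p) (Fin p) ℝ)
    (U : Matrix (Fin p) (Fin K) ℝ) : Prop where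
  orthonormal : Uᵀ * U = 1
  eigen : Q * U = U * Matrix.diagonal (fun k : Fin K => ordEig Q ((k : ℕ) + 1))

/-- The covariance matrix of a random vector. -/
def covMat {Ω : Type*} [MeasurableSpace Ω] {d : ℕ} (V : Ω → Fin d → ℝ) (P : Measure Ω) :
    Matrix (Fin d) (Fin d) ℝ :=
  Matrix.of fun i j => cov[fun ω => V ω i, fun ω => V ω j; P]

/-- The principal-components regression estimator `U (𝐗 U)⁺ 𝐲`. -/
def pcrEstimator {n p K : ℕ} (U : Matrix (Fin p) (Fin K) ℝ) (X : Matrix (Fin n) (Fin p) ℝ)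
    (y : Fin n → ℝ) : Fin p → ℝ :=
  U *ᵥ (pinv (X * U) *ᵥ y)

/-! ### The factor regression model -/

/-- The factor regression model `X = A Z + E`, `y = Zᵀ β + ε`: the latent factor `Z` and the
noise terms `E`, `ε` are mutually independent, have mean zero and finite second moments. -/
structure FactorModel {Ω : Type*} [MeasurableSpace Ω] (P : Measure Ω) (p K : ℕ) where
  /-- loading matrix -/
  A : Matrix (Fin p) (Fin K) ℝ
  /-- latent regression vector -/
  β : Fin K → ℝ
  /-- latent factor -/
  Z : Ω → Fin K → ℝ
  /-- feature noise -/
  E : Ω → Fin p → ℝ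
  /-- response noise -/
  ε : Ω → ℝ
  memLp_Z : MemLp Z 2 P
  memLp_E : MemLp E 2 P
  memLp_ε : MemLp ε 2 P
  mean_Z : ∀ k, ∫ ω, Z ω k ∂P = 0
  mean_E : ∀ j, ∫ ω, E ω j ∂P = 0
  mean_ε : ∫ ω, ε ω ∂P = 0
  indep_Z : IndepFun Z (fun ω => (E ω, ε ω)) P
  indep_E : IndepFun E ε P

namespace FactorModel

variable {Ω : Type*} [MeasurableSpace Ω] {P : Measure Ω} {p K : ℕ} (M : FactorModel P p K)

/-- The feature vector `X = A Z + E`. -/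
def X (ω : Ω) : Fin p → ℝ := M.A *ᵥ M.Z ω + M.E ω

/-- The response `y = Zᵀ β + ε`. -/
def y (ω : Ω) : ℝ := M.Z ω ⬝ᵥ M.β + M.ε ω

/-- `Σ_Z = Cov(Z)`. -/
def covZ : Matrix (Fin K) (Fin K) ℝ := covMat M.Z P

/-- `Σ_E = Cov(E)`. -/
def covE : Matrix (Fin p) (Fin p) ℝ := covMat M.E P

/-- `Σ_X = Cov(X)`. -/
def covX : Matrix (Fin p) (Fin p) ℝ := covMat M.X P

/-- `Σ_{Xy} = 𝔼[X y]`. -/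
def covXy : Fin p → ℝ := fun j => ∫ ω, M.X ω j * M.y ω ∂P

/-- `σ_ε² = Var(ε)`. -/
def noiseVar : ℝ := Var[M.ε; P]

/-- The prediction risk `R(α) = 𝔼[(Xᵀ α - y)²]` for a new data point `(X, y)`. -/
def risk (α : Fin p → ℝ) : ℝ := ∫ ω, (M.X ω ⬝ᵥ α - M.y ω) ^ 2 ∂P

/-- The best linear predictor `α* = Σ_X⁺ Σ_{Xy}`. -/
def bestLinear : Fin p → ℝ := pinv M.covX *ᵥ M.covXy

/-- The signal-to-noise ratio `ξ = λ_K(A Σ_Z Aᵀ) / ‖Σ_E‖` (meant for `Σ_E ≠ 0`). -/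
def snr : ℝ := ordEig (M.A * M.covZ * M.Aᵀ) K / opNorm M.covE

/-- Both `A` and `Σ_Z` have full rank `K`. -/
def FullRank : Prop := M.A.rank = K ∧ M.covZ.rank = K

/-- `(Z_i, E_i, ε_i)`, `i = 1, …, n`, are i.i.d. copies of `(Z, E, ε)`. -/
structure IsSample {Ω' : Type*} [MeasurableSpace Ω'] (μ : Measure Ω') {n : ℕ}
    (Zs : Fin n → Ω' → Fin K → ℝ) (Es : Fin n → Ω' → Fin p → ℝ) (εs : Fin n → Ω' → ℝ) :
    Prop where
  indep : iIndepFun (fun i ω => (Zs i ω, Es i ω, εs i ω)) μ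
  identDistrib : ∀ i, IdentDistrib (fun ω => (Zs i ω, Es i ω, εs i ω))
    (fun ω => (M.Z ω, M.E ω, M.ε ω)) μ P

/-- The `n × p` data matrix, with rows `X_i = A Z_i + E_i`. -/
def dataX {n : ℕ} (z : Fin n → Fin K → ℝ) (e : Fin n → Fin p → ℝ) :
    Matrix (Fin n) (Fin p) ℝ :=
  Matrix.of fun i => M.A *ᵥ z i + e i

/-- The response vector, with entries `y_i = Z_iᵀ β + ε_i`. -/
def dataY {n : ℕ} (z : Fin n → Fin K → ℝ) (e : Fin n → ℝ) : Fin n → ℝ :=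
  fun i => z i ⬝ᵥ M.β + e i

/-- The risk, given the sample, of the principal-components regression estimator that is computed
from the sample with the `p × K` matrix `U`. -/
def pcrRisk (U : Matrix (Fin p) (Fin K) ℝ) {Ω' : Type*} {n : ℕ} (Zs : Fin n → Ω' → Fin K → ℝ)
    (Es : Fin n → Ω' → Fin p → ℝ) (εs : Fin n → Ω' → ℝ) (ω : Ω') : ℝ :=
  M.risk (pcrEstimator U (M.dataX (fun i => Zs i ω) (fun i => Es i ω))
    (M.dataY (fun i => Zs i ω) (fun i => εs i ω)))

end FactorModel

end

/-! ### Ordered eigenvalues -/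

/-! The risk is quadratic: `R(α) = R(α*) + ‖α - α*‖²` in the norm of `Σ_X`. PCR is least squares on
the `K` features `Uᵀ X`, and its population target is the projection `b = U Uᵀ α*`, so there is a
bias and an estimation error.

Bias: on `ker Aᵀ`, of codimension at most `K`, the form of `Σ_X` equals that of `Σ_E`. By
Courant–Fischer the eigenvalues of `Σ_X` beyond the `K`-th are at most `‖Σ_E‖`, hence `R(b) ≤ R(α*)
+ ‖Σ_E‖ ‖α*‖²` (`risk_projection_le`). Since `p / n ≥ 1`, this is already within the claimed bound.

Estimation: in whitened coordinates the error is controlled by the least singular value of the `n ×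
K` design `W` and by `Wᵀ η`, with `η` the residual at `b` (`risk_pcrEstimator_le`). Both reduce to
concentration of sums of squares of scalar Gaussians (`measureReal_abs_sum_sq_sub_le`): a union
bound over a grid gives `‖W v‖² ≥ (n/5) ‖v‖²`, and each entry of `Wᵀ η` is read off by polarization
from empirical risks at `b` shifted along the whitened `k`-th direction. This yields `R(PCR) ≤ R(b)
(1 + 400 K log n / n)` off an event of probability at most `8 / n`
(`IsSample.measureReal_pcrRisk_gt_le`).

It remains to compare `R(α*)` with `σ_ε²`. The normal equations give `A Σ_Z (Aᵀ α* - β) = -Σ_E α*`,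
whence the bound through `1 + ξ⁻¹`; the competitor solving `Aᵀ α = β` with small norm gives `R(α*) -
σ_ε² ≤ ‖β‖²_{Σ_Z} / ξ`. The latter also bounds `λ_p(Σ_E) ‖α*‖²`, which brings in the condition
number. -/

theorem ordEig_antitone {d : ℕ} {Q : Matrix (Fin d) (Fin d) ℝ} (hQ : Q.IsHermitian) {i j : ℕ}
    (hi : 1 ≤ i) (hij : i ≤ j) (hj : j ≤ d) : ordEig Q j ≤ ordEig Q i := by
  unfold ordEig
  rw [dif_pos ⟨hQ, hi.trans hij, hj⟩, dif_pos ⟨hQ, hi, hij.trans hj⟩]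
  apply hQ.eigenvalues₀_antitone
  simp only [Fin.mk_le_mk]
  omega

theorem exists_ordEig_diagonalization {d : ℕ} {Q : Matrix (Fin d) (Fin d) ℝ}
    (hQ : Q.IsHermitian) :
    ∃ V : Matrix (Fin d) (Fin d) ℝ, Vᵀ * V = 1 ∧ V * Vᵀ = 1 ∧
      Q = V * Matrix.diagonal (fun j : Fin d => ordEig Q (j + 1)) * Vᵀ := by
  -- `eigenvalues` is an arbitrary relabelling of the sorted list `eigenvalues₀`; `σ` undoes it.
  -- Indices of `ordEig` start at 1, hence the shift `j + 1`.
  let σ : Fin d ≃ Fin d :=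
    (finCongr (Fintype.card_fin d)).symm.trans (Fintype.equivOfCardEq (Fintype.card_fin _))
  have hσ : ∀ j, hQ.eigenvalues (σ j) = ordEig Q (j + 1) := by
    intro j
    unfold ordEig
    rw [dif_pos ⟨hQ, by omega, by omega⟩]
    simp [Matrix.IsHermitian.eigenvalues, σ]
    congr
  set W : Matrix (Fin d) (Fin d) ℝ := (hQ.eigenvectorUnitary : Matrix (Fin d) (Fin d) ℝ) with hW
  have hWW : Wᵀ * W = 1 := by
    have h := Unitary.coe_star_mul_self hQ.eigenvectorUnitary
    rwa [Matrix.star_eq_conjTranspose, Matrix.conjTranspose_eq_transpose_of_trivial] at h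
  have hS : Q = W * Matrix.diagonal hQ.eigenvalues * Wᵀ := by
    have h := hQ.spectral_theorem
    rw [Unitary.conjStarAlgAut_apply, Matrix.star_eq_conjTranspose,
      Matrix.conjTranspose_eq_transpose_of_trivial] at h
    exact h
  have hVV : (W.submatrix id σ)ᵀ * W.submatrix id σ = 1 := by
    rw [Matrix.transpose_submatrix, ← Equiv.coe_refl, Matrix.submatrix_mul_equiv, hWW,
      Matrix.submatrix_one_equiv]
  refine ⟨W.submatrix id σ, hVV, mul_eq_one_comm.1 hVV, ?_⟩
  have hD : Matrix.diagonal (fun j : Fin d => ordEig Q (j + 1))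
      = (Matrix.diagonal hQ.eigenvalues).submatrix σ σ := by
    rw [Matrix.submatrix_diagonal_equiv]
    congr 1
    funext j
    exact (hσ j).symm
  rw [hD, Matrix.transpose_submatrix, Matrix.submatrix_mul_equiv, Matrix.submatrix_mul_equiv, ← hS,
    Matrix.submatrix_id_id]

section Diagonalized

variable {d : ℕ} {Q V : Matrix (Fin d) (Fin d) ℝ} {l : Fin d → ℝ}

theorem dotProduct_self_eq_sum_sq {m : ℕ} (x : Fin m → ℝ) : x ⬝ᵥ x = ∑ j, x j ^ 2 := by
  simp [dotProduct, sq]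

theorem dotProduct_self_nonneg' {m : ℕ} (x : Fin m → ℝ) : 0 ≤ x ⬝ᵥ x := by
  rw [dotProduct_self_eq_sum_sq]; positivity

theorem dotProduct_mulVec_transpose {m k : ℕ} (B : Matrix (Fin m) (Fin k) ℝ) (x : Fin m → ℝ)
    (y : Fin k → ℝ) : x ⬝ᵥ (B *ᵥ y) = (Bᵀ *ᵥ x) ⬝ᵥ y := by
  rw [Matrix.dotProduct_mulVec, Matrix.mulVec_transpose]

theorem mulVec_dotProduct_mulVec {m k : ℕ} (B : Matrix (Fin m) (Fin k) ℝ) (x y : Fin k → ℝ) :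
    (B *ᵥ x) ⬝ᵥ (B *ᵥ y) = x ⬝ᵥ ((Bᵀ * B) *ᵥ y) := by
  rw [← Matrix.mulVec_mulVec, dotProduct_mulVec_transpose Bᵀ, Matrix.transpose_transpose]

theorem dotProduct_self_of_orthogonal (h2 : V * Vᵀ = 1) (x : Fin d → ℝ) :
    x ⬝ᵥ x = ∑ j, (Vᵀ *ᵥ x) j ^ 2 := by
  rw [← dotProduct_self_eq_sum_sq, mulVec_dotProduct_mulVec, Matrix.transpose_transpose, h2,
    Matrix.one_mulVec]

theorem transpose_mulVec_of_diagonalized (h1 : Vᵀ * V = 1)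
    (hQ : Q = V * Matrix.diagonal l * Vᵀ) (x : Fin d → ℝ) (j : Fin d) :
    (Vᵀ *ᵥ (Q *ᵥ x)) j = l j * (Vᵀ *ᵥ x) j := by
  rw [hQ, Matrix.mulVec_mulVec, ← Matrix.mul_assoc, ← Matrix.mul_assoc, h1, Matrix.one_mul,
    ← Matrix.mulVec_mulVec, Matrix.mulVec_diagonal]

theorem wNormSq_of_diagonalized (hQ : Q = V * Matrix.diagonal l * Vᵀ)
    (x : Fin d → ℝ) : wNormSq Q x = ∑ j, l j * (Vᵀ *ᵥ x) j ^ 2 := by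
  unfold wNormSq
  rw [hQ, ← Matrix.mulVec_mulVec, ← Matrix.mulVec_mulVec, dotProduct_mulVec_transpose]
  simp only [dotProduct, Matrix.mulVec_diagonal]
  exact Finset.sum_congr rfl fun j _ => by ring

theorem mulVec_sq_of_diagonalized (h1 : Vᵀ * V = 1) (h2 : V * Vᵀ = 1)
    (hQ : Q = V * Matrix.diagonal l * Vᵀ) (x : Fin d → ℝ) :
    (Q *ᵥ x) ⬝ᵥ (Q *ᵥ x) = ∑ j, l j ^ 2 * (Vᵀ *ᵥ x) j ^ 2 := by
  rw [dotProduct_self_of_orthogonal h2]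
  refine Finset.sum_congr rfl fun j _ => ?_
  rw [transpose_mulVec_of_diagonalized h1 hQ]
  ring

theorem eigenvalue_nonneg_of_wNormSq_nonneg (h1 : Vᵀ * V = 1)
    (hQ : Q = V * Matrix.diagonal l * Vᵀ) (hpos : ∀ x, 0 ≤ wNormSq Q x) (j : Fin d) : 0 ≤ l j := by
  have h := hpos (V *ᵥ Pi.single j 1)
  rw [wNormSq_of_diagonalized hQ, Matrix.mulVec_mulVec, h1, Matrix.one_mulVec] at h
  simpa [Pi.single_apply] using h

theorem rank_of_diagonalized (h1 : Vᵀ * V = 1) (h2 : V * Vᵀ = 1)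
    (hQ : Q = V * Matrix.diagonal l * Vᵀ) : Q.rank = Fintype.card {j // l j ≠ 0} := by
  have hV : IsUnit V.det := (Matrix.isUnit_iff_isUnit_det _).1 (IsUnit.of_mul_eq_one _ h2)
  have hV' : IsUnit Vᵀ.det := (Matrix.isUnit_iff_isUnit_det _).1 (IsUnit.of_mul_eq_one _ h1)
  rw [hQ, Matrix.rank_mul_eq_left_of_isUnit_det _ _ hV',
    Matrix.rank_mul_eq_right_of_isUnit_det _ _ hV, Matrix.rank_diagonal]

end Diagonalized

theorem ordEig_nonneg {d : ℕ} {Q : Matrix (Fin d) (Fin d) ℝ} (hQ : Q.IsHermitian)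
    (hpos : ∀ x, 0 ≤ wNormSq Q x) (j : Fin d) : 0 ≤ ordEig Q (j + 1) := by
  obtain ⟨V, h1, -, h⟩ := exists_ordEig_diagonalization hQ
  exact eigenvalue_nonneg_of_wNormSq_nonneg h1 h hpos j

theorem rank_eq_card_ordEig {d : ℕ} {Q : Matrix (Fin d) (Fin d) ℝ} (hQ : Q.IsHermitian) :
    Q.rank = (Finset.univ.filter fun j : Fin d => ordEig Q (j + 1) ≠ 0).card := by
  obtain ⟨V, h1, h2, h⟩ := exists_ordEig_diagonalization hQ
  rw [rank_of_diagonalized h1 h2 h, Fintype.card_subtype]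

/-- The rank counts nonzero eigenvalues. A zero at index `j < K` would confine them to the `j`
earlier indices, fewer than `K`. -/
theorem ordEig_pos_of_le_rank {d K : ℕ} {Q : Matrix (Fin d) (Fin d) ℝ} (hQ : Q.IsHermitian)
    (hpos : ∀ x, 0 ≤ wNormSq Q x) (hK : K ≤ Q.rank) (j : Fin d) (hj : (j : ℕ) < K) :
    0 < ordEig Q (j + 1) := by
  refine lt_of_le_of_ne (ordEig_nonneg hQ hpos j) fun h0 => ?_
  have hsub : (Finset.univ.filter fun i : Fin d => ordEig Q (i + 1) ≠ 0) ⊆ Finset.Iio j := by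
    intro i hi
    simp only [Finset.mem_filter, Finset.mem_univ, true_and] at hi
    rw [Finset.mem_Iio]
    by_contra hij
    rw [not_lt] at hij
    apply hi
    refine le_antisymm ?_ (ordEig_nonneg hQ hpos i)
    rw [h0]
    exact ordEig_antitone hQ (by omega) (by simpa using hij) (by omega)
  have := Finset.card_le_card hsub
  rw [← rank_eq_card_ordEig hQ, Fin.card_Iio] at this
  omega

theorem ordEig_eq_zero_of_rank_le {d K : ℕ} {Q : Matrix (Fin d) (Fin d) ℝ} (hQ : Q.IsHermitian)
    (hpos : ∀ x, 0 ≤ wNormSq Q x) (hK : Q.rank ≤ K) (j : Fin d) (hj : K ≤ (j : ℕ)) :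
    ordEig Q (j + 1) = 0 := by
  by_contra h0
  have hjpos := lt_of_le_of_ne (ordEig_nonneg hQ hpos j) (Ne.symm h0)
  have hsub : Finset.Iic j ⊆ (Finset.univ.filter fun i : Fin d => ordEig Q (i + 1) ≠ 0) := by
    intro i hi
    simp only [Finset.mem_filter, Finset.mem_univ, true_and]
    rw [Finset.mem_Iic] at hi
    refine (hjpos.trans_le ?_).ne'
    exact ordEig_antitone hQ (by omega) (by simpa using hi) (by omega)
  have := Finset.card_le_card hsub
  rw [← rank_eq_card_ordEig hQ, Fin.card_Iic] at this
  omega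

/-- A positive semidefinite matrix of rank at most `K` has no eigenvalue strictly between `0` and
its `K`-th ordered eigenvalue. -/
theorem ordEig_mul_wNormSq_le {d K : ℕ} {Q : Matrix (Fin d) (Fin d) ℝ} (hQ : Q.IsHermitian)
    (hpos : ∀ x, 0 ≤ wNormSq Q x) (hrank : Q.rank ≤ K) (hKd : K ≤ d)
    (x : Fin d → ℝ) : ordEig Q K * wNormSq Q x ≤ (Q *ᵥ x) ⬝ᵥ (Q *ᵥ x) := by
  obtain ⟨V, h1, h2, h⟩ := exists_ordEig_diagonalization hQ
  rw [mulVec_sq_of_diagonalized h1 h2 h, wNormSq_of_diagonalized h, Finset.mul_sum]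
  refine Finset.sum_le_sum fun j _ => ?_
  by_cases hj : K ≤ (j : ℕ)
  · simp [ordEig_eq_zero_of_rank_le hQ hpos hrank j hj]
  · have := ordEig_antitone hQ (i := j + 1) (j := K) (by omega) (by omega) hKd
    have := mul_le_mul_of_nonneg_right this (ordEig_nonneg hQ hpos j)
    nlinarith [sq_nonneg ((Vᵀ *ᵥ x) j)]

/-- Dropping the eigencoordinates of `x` from index `K` on changes nothing after applying `Q`, since
those eigenvalues vanish; the remaining ones are at least the `K`-th. -/
theorem exists_mulVec_eq_and_ordEig_mul_le {d K : ℕ} {Q : Matrix (Fin d) (Fin d) ℝ}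
    (hQ : Q.IsHermitian)
    (hpos : ∀ x, 0 ≤ wNormSq Q x) (hrank : Q.rank ≤ K) (hKd : K ≤ d)
    (x : Fin d → ℝ) : ∃ x₀, Q *ᵥ x₀ = Q *ᵥ x ∧ ordEig Q K * (x₀ ⬝ᵥ x₀) ≤ wNormSq Q x₀ := by
  obtain ⟨V, h1, h2, h⟩ := exists_ordEig_diagonalization hQ
  set c : Fin d → ℝ := fun j => if K ≤ (j : ℕ) then 0 else (Vᵀ *ᵥ x) j with hc
  have hcV : Vᵀ *ᵥ (V *ᵥ c) = c := by rw [Matrix.mulVec_mulVec, h1, Matrix.one_mulVec]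
  refine ⟨V *ᵥ c, ?_, ?_⟩
  · have key : Vᵀ *ᵥ (Q *ᵥ (V *ᵥ c)) = Vᵀ *ᵥ (Q *ᵥ x) := by
      funext j
      rw [transpose_mulVec_of_diagonalized h1 h, transpose_mulVec_of_diagonalized h1 h, hcV]
      by_cases hj : K ≤ (j : ℕ)
      · simp [ordEig_eq_zero_of_rank_le hQ hpos hrank j hj]
      · simp [hc, hj]
    have := congrArg (V *ᵥ ·) key
    simpa only [Matrix.mulVec_mulVec, ← Matrix.mul_assoc, h2, Matrix.one_mul] using this
  · rw [wNormSq_of_diagonalized h, dotProduct_self_of_orthogonal h2, Finset.mul_sum, hcV]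
    refine Finset.sum_le_sum fun j _ => ?_
    by_cases hj : K ≤ (j : ℕ)
    · simp [hc, hj]
    · exact mul_le_mul_of_nonneg_right
        (ordEig_antitone hQ (by omega) (by omega) hKd) (sq_nonneg _)

theorem ordEig_last_mul_le_wNormSq {d : ℕ} {Q : Matrix (Fin d) (Fin d) ℝ} (hQ : Q.IsHermitian)
    (x : Fin d → ℝ) : ordEig Q d * (x ⬝ᵥ x) ≤ wNormSq Q x := by
  obtain ⟨V, h1, h2, h⟩ := exists_ordEig_diagonalization hQ
  rw [wNormSq_of_diagonalized h, dotProduct_self_of_orthogonal h2, Finset.mul_sum]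
  exact Finset.sum_le_sum fun j _ => mul_le_mul_of_nonneg_right
    (ordEig_antitone hQ (by omega) (by omega) le_rfl) (sq_nonneg _)

/-! ### Operator norm -/

theorem norm_toLp_sq {d : ℕ} (x : Fin d → ℝ) : ‖WithLp.toLp 2 x‖ ^ 2 = x ⬝ᵥ x := by
  rw [EuclideanSpace.real_norm_sq_eq, dotProduct_self_eq_sum_sq]

theorem opNorm_nonneg {d : ℕ} (Q : Matrix (Fin d) (Fin d) ℝ) : 0 ≤ opNorm Q := norm_nonneg _

theorem mulVec_sq_le_opNorm_sq {d : ℕ} (Q : Matrix (Fin d) (Fin d) ℝ) (x : Fin d → ℝ) :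
    (Q *ᵥ x) ⬝ᵥ (Q *ᵥ x) ≤ opNorm Q ^ 2 * (x ⬝ᵥ x) := by
  have h := (Matrix.toEuclideanCLM (𝕜 := ℝ) Q).le_opNorm (WithLp.toLp 2 x)
  rw [Matrix.toEuclideanCLM_toLp] at h
  rw [← norm_toLp_sq, ← norm_toLp_sq, ← mul_pow]
  exact pow_le_pow_left₀ (norm_nonneg _) h 2

theorem dotProduct_sq_le {d : ℕ} (x y : Fin d → ℝ) : (x ⬝ᵥ y) ^ 2 ≤ (x ⬝ᵥ x) * (y ⬝ᵥ y) := by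
  rw [dotProduct_self_eq_sum_sq, dotProduct_self_eq_sum_sq]
  exact Finset.sum_mul_sq_le_sq_mul_sq _ _ _

theorem wNormSq_le_opNorm_mul {d : ℕ} (Q : Matrix (Fin d) (Fin d) ℝ) (x : Fin d → ℝ) :
    wNormSq Q x ≤ opNorm Q * (x ⬝ᵥ x) := by
  have h1 := dotProduct_sq_le x (Q *ᵥ x)
  have h2 := mulVec_sq_le_opNorm_sq Q x
  have hx := dotProduct_self_nonneg' x
  refine abs_le_of_sq_le_sq' (a := wNormSq Q x) ?_ (mul_nonneg (opNorm_nonneg Q) hx) |>.2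
  calc wNormSq Q x ^ 2 ≤ _ := h1
    _ ≤ (x ⬝ᵥ x) * (opNorm Q ^ 2 * (x ⬝ᵥ x)) := mul_le_mul_of_nonneg_left h2 hx
    _ = _ := by ring

theorem opNorm_le_ordEig_one {d : ℕ} {Q : Matrix (Fin d) (Fin d) ℝ} (hQ : Q.IsHermitian)
    (hpos : ∀ x, 0 ≤ wNormSq Q x) (hd : 1 ≤ d) : opNorm Q ≤ ordEig Q 1 := by
  obtain ⟨V, h1, h2, h⟩ := exists_ordEig_diagonalization hQ
  have h0 : 0 ≤ ordEig Q 1 := ordEig_nonneg hQ hpos ⟨0, hd⟩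
  refine ContinuousLinearMap.opNorm_le_bound _ h0 fun x => ?_
  refine abs_le_of_sq_le_sq' ?_ (mul_nonneg h0 (norm_nonneg _)) |>.2
  rw [mul_pow, ← WithLp.toLp_ofLp (p := 2) x, Matrix.toEuclideanCLM_toLp, norm_toLp_sq,
    norm_toLp_sq, mulVec_sq_of_diagonalized h1 h2 h, dotProduct_self_of_orthogonal h2,
    Finset.mul_sum]
  exact Finset.sum_le_sum fun j _ => mul_le_mul_of_nonneg_right
    (pow_le_pow_left₀ (ordEig_nonneg hQ hpos j)
      (ordEig_antitone hQ le_rfl (by omega) (by omega)) 2) (sq_nonneg _)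

/-! ### Spectrum of a low rank matrix plus noise -/

/-- If the quadratic form of `S` is at most `s` on the kernel of the `K × p` matrix `Aᵀ`, then the
`(K + 1)`-th eigenvalue of `S` is at most `s`. -/
theorem ordEig_le_of_wNormSq_le_on_ker {p K : ℕ} {S : Matrix (Fin p) (Fin p) ℝ}
    (hS : S.IsHermitian) {A : Matrix (Fin p) (Fin K) ℝ} {s : ℝ}
    (hs : ∀ z, Aᵀ *ᵥ z = 0 → wNormSq S z ≤ s * (z ⬝ᵥ z)) (j : Fin p) (hj : K ≤ (j : ℕ)) :
    ordEig S (j + 1) ≤ s := by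
  obtain ⟨V, h1, h2, h⟩ := exists_ordEig_diagonalization hS
  have hKp : K + 1 ≤ p := by omega
  -- `W` embeds the first `K + 1` eigencoordinates. A space of dimension `K + 1` contains a nonzero
  -- vector killed by the `K` equations `Aᵀ z = 0`, and there the form is at least the `(K + 1)`-th
  -- eigenvalue.
  let W : Matrix (Fin p) (Fin (K + 1)) ℝ :=
    Matrix.of fun i k => if i = Fin.castLE hKp k then 1 else 0
  have hW : ∀ c : Fin (K + 1) → ℝ, ∀ i : Fin p, ∀ hi : (i : ℕ) < K + 1,
      (W *ᵥ c) i = c ⟨i, hi⟩ := by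
    intro c i hi
    rw [Matrix.mulVec, dotProduct, Finset.sum_eq_single ⟨i, hi⟩]
    · simp [W, Fin.ext_iff]
    · intro k _ hk
      simp only [W, Matrix.of_apply, Fin.ext_iff, Fin.val_castLE, ne_eq] at hk ⊢
      simp [Ne.symm hk]
    · simp
  have hW0 : ∀ c : Fin (K + 1) → ℝ, ∀ i : Fin p, ¬ (i : ℕ) < K + 1 → (W *ᵥ c) i = 0 := by
    intro c i hi
    rw [Matrix.mulVec, dotProduct]
    refine Finset.sum_eq_zero fun k _ => ?_
    have : (i : ℕ) ≠ k := by omega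
    simp [W, Fin.ext_iff, this]
  have hker : LinearMap.ker (Matrix.mulVecLin (Aᵀ * V * W)) ≠ ⊥ :=
    LinearMap.ker_ne_bot_of_finrank_lt (by simp)
  obtain ⟨c, hc, hc0⟩ := (Submodule.ne_bot_iff _).1 hker
  rw [LinearMap.mem_ker, Matrix.mulVecLin_apply, ← Matrix.mulVec_mulVec,
    ← Matrix.mulVec_mulVec] at hc
  have hz := hs _ hc
  have hV : Vᵀ *ᵥ (V *ᵥ (W *ᵥ c)) = W *ᵥ c := by rw [Matrix.mulVec_mulVec, h1, Matrix.one_mulVec]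
  rw [wNormSq_of_diagonalized h, dotProduct_self_of_orthogonal h2, hV] at hz
  have hpos : 0 < ∑ i, (W *ᵥ c) i ^ 2 := by
    obtain ⟨k, hk⟩ := Function.ne_iff.1 hc0
    have hk' : (W *ᵥ c) (Fin.castLE hKp k) = c k := hW c _ k.2
    refine Finset.sum_pos' (fun i _ => sq_nonneg _) ⟨Fin.castLE hKp k, Finset.mem_univ _, ?_⟩
    rw [hk']
    exact sq_pos_of_ne_zero hk
  have hle : ordEig S (j + 1) * ∑ i, (W *ᵥ c) i ^ 2
      ≤ ∑ i : Fin p, ordEig S (i + 1) * (W *ᵥ c) i ^ 2 := by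
    rw [Finset.mul_sum]
    refine Finset.sum_le_sum fun i _ => ?_
    by_cases hi : (i : ℕ) < K + 1
    · exact mul_le_mul_of_nonneg_right (ordEig_antitone hS (by omega) (by omega) (by omega))
        (sq_nonneg _)
    · simp [hW0 c i hi]
  exact le_of_mul_le_mul_right (hle.trans hz) hpos

/-- Eigenvectors for eigenvalues outside the top `K` see the bound `s` only, as soon as at most `K`
eigenvalues exceed `s`. -/
theorem IsTopEigenvectors.wNormSq_le_of_orthogonal {p K : ℕ} {S : Matrix (Fin p) (Fin p) ℝ}
    {U : Matrix (Fin p) (Fin K) ℝ} (hU : IsTopEigenvectors S U) (hS : S.IsHermitian) {s : ℝ}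
    (hKp : K ≤ p) (hs : ∀ j : Fin p, K ≤ (j : ℕ) → ordEig S (j + 1) ≤ s) (x : Fin p → ℝ)
    (hx : Uᵀ *ᵥ x = 0) : wNormSq S x ≤ s * (x ⬝ᵥ x) := by
  obtain ⟨V, h1, h2, h⟩ := exists_ordEig_diagonalization hS
  -- Eigenvectors are not unique under ties, so `U` need not consist of columns of `V`. `R`
  -- expresses `U` in the basis `V`; its entries vanish between distinct eigenvalues, and `T = R Rᵀ`
  -- is the projection onto the span of `U`.
  set R : Matrix (Fin p) (Fin K) ℝ := Vᵀ * U with hR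
  have hRR : Rᵀ * R = 1 := by
    rw [hR, Matrix.transpose_mul, Matrix.transpose_transpose, Matrix.mul_assoc,
      ← Matrix.mul_assoc V, h2, Matrix.one_mul, hU.orthonormal]
  have hcomm : ∀ (j : Fin p) (k : Fin K),
      ordEig S (j + 1) * R j k = R j k * ordEig S ((k : ℕ) + 1) := by
    intro j k
    have e : Matrix.diagonal (fun j : Fin p => ordEig S (j + 1)) * R
        = R * Matrix.diagonal (fun k : Fin K => ordEig S ((k : ℕ) + 1)) := by
      rw [hR, Matrix.mul_assoc Vᵀ, ← hU.eigen]
      conv_rhs => rw [h]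
      simp only [Matrix.mul_assoc]
      rw [← Matrix.mul_assoc Vᵀ V, h1, Matrix.one_mul]
    have := congrFun (congrFun e j) k
    rwa [Matrix.diagonal_mul, Matrix.mul_diagonal] at this
  have hcol : ∀ k, ∑ j, R j k ^ 2 = 1 := by
    intro k
    have := congrFun (congrFun hRR k) k
    simpa [Matrix.mul_apply, sq] using this
  set T : Matrix (Fin p) (Fin p) ℝ := R * Rᵀ with hT
  have hTT : T * T = T := by
    rw [hT, Matrix.mul_assoc, ← Matrix.mul_assoc Rᵀ, hRR, Matrix.one_mul]
  have hTsym : ∀ i j, T i j = T j i := by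
    intro i j
    simp only [hT, Matrix.mul_apply, Matrix.transpose_apply]
    exact Finset.sum_congr rfl fun k _ => mul_comm _ _
  have hTdiag : ∀ j, T j j = ∑ k, R j k ^ 2 := by
    intro j
    simp [hT, Matrix.mul_apply, sq]
  have hTsq : ∀ j, ∑ i, T j i ^ 2 = T j j := by
    intro j
    conv_rhs => rw [← hTT]
    rw [Matrix.mul_apply]
    exact Finset.sum_congr rfl fun i _ => by rw [hTsym i j]; ring
  have hTle : ∀ j, T j j ≤ 1 := by
    intro j
    have h3 : T j j ^ 2 ≤ ∑ i, T j i ^ 2 :=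
      Finset.single_le_sum (f := fun i => T j i ^ 2) (fun i _ => sq_nonneg _) (Finset.mem_univ j)
    rw [hTsq] at h3
    nlinarith
  let J : Finset (Fin K) := Finset.univ.filter fun k => s < ordEig S ((k : ℕ) + 1)
  have hmemJ : ∀ k, k ∈ J ↔ s < ordEig S ((k : ℕ) + 1) := by simp [J]
  -- Columns of `R` indexed by `J` (eigenvalue above `s`) are unit vectors supported on rows in `J`.
  -- The total mass `|J|` thus fits into `|J|` rows of mass `T j j ≤ 1`, which forces equality in
  -- each.
  have hone : ∀ k ∈ J, T (Fin.castLE hKp k) (Fin.castLE hKp k) = 1 := by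
    have hsum : (∑ k ∈ J, (1 : ℝ)) ≤ ∑ k ∈ J, T (Fin.castLE hKp k) (Fin.castLE hKp k) := by
      calc (∑ k ∈ J, (1 : ℝ)) = ∑ k ∈ J, ∑ j, R j k ^ 2 :=
            Finset.sum_congr rfl fun k _ => (hcol k).symm
        _ = ∑ k ∈ J, ∑ i ∈ J, R (Fin.castLE hKp i) k ^ 2 := by
            refine Finset.sum_congr rfl fun k hk => ?_
            refine Eq.trans ?_ (Finset.sum_map J (Fin.castLEEmb hKp) (fun j => R j k ^ 2))
            symm
            refine Finset.sum_subset (Finset.subset_univ _) fun j _ hj => ?_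
            have hne : ordEig S (j + 1) ≠ ordEig S ((k : ℕ) + 1) := by
              intro he
              rw [hmemJ, ← he] at hk
              have hjK : (j : ℕ) < K := by
                by_contra hjK
                exact absurd (hs j (by omega)) (not_le.2 hk)
              exact hj (Finset.mem_map.2 ⟨⟨j, hjK⟩, (hmemJ _).2 hk, by ext; simp⟩)
            have := hcomm j k
            have : (ordEig S (j + 1) - ordEig S ((k : ℕ) + 1)) * R j k = 0 := by linarith
            rcases mul_eq_zero.1 this with h0 | h0
            · exact absurd (sub_eq_zero.1 h0) hne
            · rw [h0]; ring
        _ = ∑ i ∈ J, ∑ k ∈ J, R (Fin.castLE hKp i) k ^ 2 := Finset.sum_comm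
        _ ≤ _ := by
            refine Finset.sum_le_sum fun i _ => ?_
            rw [hTdiag]
            exact Finset.sum_le_sum_of_subset_of_nonneg (Finset.subset_univ _)
              fun _ _ _ => sq_nonneg _
    exact (Finset.sum_eq_sum_iff_of_le fun k _ => hTle _).1
      (le_antisymm (Finset.sum_le_sum fun k _ => hTle _) hsum)
  have hTx : T *ᵥ (Vᵀ *ᵥ x) = 0 := by
    rw [hT, hR, Matrix.transpose_mul, Matrix.transpose_transpose, Matrix.mulVec_mulVec,
      Matrix.mul_assoc, Matrix.mul_assoc, Matrix.mul_assoc, h2, Matrix.mul_one,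
      ← Matrix.mulVec_mulVec, ← Matrix.mulVec_mulVec, hx, Matrix.mulVec_zero, Matrix.mulVec_zero]
  rw [wNormSq_of_diagonalized h, dotProduct_self_of_orthogonal h2, Finset.mul_sum]
  refine Finset.sum_le_sum fun j _ => ?_
  by_cases hj : ordEig S (j + 1) ≤ s
  · exact mul_le_mul_of_nonneg_right hj (sq_nonneg _)
  · have hjK : (j : ℕ) < K := by
      by_contra hjK
      exact hj (hs j (by omega))
    have hTj : T j j = 1 := hone ⟨j, hjK⟩ ((hmemJ _).2 (not_le.1 hj))
    -- For a projection `∑ i, T j i ^ 2 = T j j = 1`, so the off-diagonal part of the row vanishes.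
    -- With `T Vᵀ x = 0` this kills the `j`-th coordinate of `x`.
    have hoff : ∀ i, i ≠ j → T j i = 0 := by
      intro i hi
      have h3 := hTsq j
      rw [← Finset.add_sum_erase _ _ (Finset.mem_univ j), hTj] at h3
      have h4 : ∑ i ∈ Finset.univ.erase j, T j i ^ 2 = 0 := by linarith
      have := (Finset.sum_eq_zero_iff_of_nonneg fun i _ => sq_nonneg _).1 h4 i
        (Finset.mem_erase.2 ⟨hi, Finset.mem_univ i⟩)
      exact pow_eq_zero_iff (two_ne_zero) |>.1 this
    have h5 := congrFun hTx j
    rw [Matrix.mulVec, dotProduct, Finset.sum_eq_single j (fun i _ hi => by rw [hoff i hi, zero_mul])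
      (by simp), hTj, one_mul] at h5
    rw [h5]
    simp

/-! ### The population regression problem -/

section LowRankPlusNoise

variable {p K : ℕ} {A : Matrix (Fin p) (Fin K) ℝ} {G : Matrix (Fin K) (Fin K) ℝ}
  {N : Matrix (Fin p) (Fin p) ℝ}

theorem wNormSq_mul_mul_transpose (x : Fin p → ℝ) :
    wNormSq (A * G * Aᵀ) x = wNormSq G (Aᵀ *ᵥ x) := by
  unfold wNormSq
  rw [← Matrix.mulVec_mulVec, ← Matrix.mulVec_mulVec, dotProduct_mulVec_transpose]

theorem wNormSq_add {d : ℕ} (Q R : Matrix (Fin d) (Fin d) ℝ) (x : Fin d → ℝ) :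
    wNormSq (Q + R) x = wNormSq Q x + wNormSq R x := by
  unfold wNormSq
  rw [Matrix.add_mulVec, dotProduct_add]

theorem isHermitian_mul_mul_transpose (hG : G.IsHermitian) : (A * G * Aᵀ).IsHermitian := by
  have := Matrix.isHermitian_mul_mul_conjTranspose A hG
  rwa [Matrix.conjTranspose_eq_transpose_of_trivial] at this

theorem mulVec_eq_zero_of_wNormSq_eq_zero (hG : ∀ x, x ≠ 0 → 0 < wNormSq G x)
    {z : Fin p → ℝ} (hz : wNormSq (A * G * Aᵀ) z = 0) : Aᵀ *ᵥ z = 0 := by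
  by_contra h
  have := hG _ h
  rw [← wNormSq_mul_mul_transpose, hz] at this
  exact lt_irrefl _ this

theorem wNormSq_pos_of_rank {d : ℕ} {Q : Matrix (Fin d) (Fin d) ℝ} (hQ : Q.IsHermitian)
    (hpos : ∀ x, 0 ≤ wNormSq Q x) (hrank : Q.rank = d) {x : Fin d → ℝ} (hx : x ≠ 0) :
    0 < wNormSq Q x := by
  have hd : 1 ≤ d := by
    rcases Nat.eq_zero_or_pos d with rfl | h
    · exact absurd (Subsingleton.elim x 0) hx
    · exact h
  have h1 : 0 < ordEig Q d := by
    have := ordEig_pos_of_le_rank hQ hpos hrank.ge ⟨d - 1, by omega⟩ (by simp; omega)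
    simpa [Nat.sub_add_cancel hd] using this
  refine lt_of_lt_of_le (mul_pos h1 ?_) (ordEig_last_mul_le_wNormSq hQ x)
  exact lt_of_le_of_ne (dotProduct_self_nonneg' x)
    fun h => hx (dotProduct_self_eq_zero.1 h.symm)

/-- The kernel of `S` lies in the kernel of `Aᵀ`; rank–nullity reverses the inclusion. -/
theorem le_rank_of_wNormSq_ker {S : Matrix (Fin p) (Fin p) ℝ} (hA : A.rank = K)
    (hker : ∀ z, wNormSq S z = 0 → Aᵀ *ᵥ z = 0) : K ≤ S.rank := by
  have hle : LinearMap.ker S.mulVecLin ≤ LinearMap.ker Aᵀ.mulVecLin := by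
    intro z hz
    rw [LinearMap.mem_ker, Matrix.mulVecLin_apply] at hz ⊢
    exact hker z (by rw [wNormSq, hz, dotProduct_zero])
  have h1 := Submodule.finrank_mono hle
  have h2 := LinearMap.finrank_range_add_finrank_ker S.mulVecLin
  have h3 := LinearMap.finrank_range_add_finrank_ker Aᵀ.mulVecLin
  have h4 : Aᵀ.rank = K := by rw [Matrix.rank_transpose, hA]
  rw [Matrix.rank] at h4 ⊢
  omega

theorem exists_transpose_mulVec_eq (hA : A.rank = K) (w : Fin K → ℝ) : ∃ x, Aᵀ *ᵥ x = w := by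
  have h4 : Aᵀ.rank = K := by rw [Matrix.rank_transpose, hA]
  have : LinearMap.range Aᵀ.mulVecLin = ⊤ := by
    apply Submodule.eq_top_of_finrank_eq
    rw [Matrix.rank] at h4
    simpa using h4
  exact LinearMap.range_eq_top.1 this w

/-- The nonzero eigenvalues of `A G Aᵀ` bound `‖A G w‖²` from below. -/
theorem ordEig_mul_wNormSq_le_sq (hA : A.rank = K) (hG : G.IsHermitian)
    (hpos : ∀ x, 0 ≤ wNormSq G x) (w : Fin K → ℝ) :
    ordEig (A * G * Aᵀ) K * wNormSq G w ≤ (A *ᵥ (G *ᵥ w)) ⬝ᵥ (A *ᵥ (G *ᵥ w)) := by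
  obtain ⟨x, rfl⟩ := exists_transpose_mulVec_eq hA w
  have hKp : K ≤ p := by
    have := A.rank_le_height
    omega
  have := ordEig_mul_wNormSq_le (K := K) (isHermitian_mul_mul_transpose (A := A) hG)
    (fun x => by rw [wNormSq_mul_mul_transpose]; exact hpos _)
    (by rw [Matrix.mul_assoc]; exact (Matrix.rank_mul_le_left _ _).trans hA.le) hKp x
  rwa [wNormSq_mul_mul_transpose, ← Matrix.mulVec_mulVec, ← Matrix.mulVec_mulVec] at this

/-- The equation `Aᵀ α = β` has a solution that is small if `‖β‖_G` is. -/
theorem exists_transpose_mulVec_eq_and_le (hA : A.rank = K) (hG : G.IsHermitian)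
    (hpos : ∀ x, x ≠ 0 → 0 < wNormSq G x) (β : Fin K → ℝ) :
    ∃ α, Aᵀ *ᵥ α = β ∧ ordEig (A * G * Aᵀ) K * (α ⬝ᵥ α) ≤ wNormSq G β := by
  obtain ⟨x, rfl⟩ := exists_transpose_mulVec_eq hA β
  have hKp : K ≤ p := by
    have := A.rank_le_height
    omega
  have hpos' : ∀ x, 0 ≤ wNormSq G x := fun x => by
    by_cases hx : x = 0
    · simp [hx, wNormSq]
    · exact (hpos x hx).le
  obtain ⟨α, h1, h2⟩ := exists_mulVec_eq_and_ordEig_mul_le (K := K)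
    (isHermitian_mul_mul_transpose (A := A) hG)
    (fun x => by rw [wNormSq_mul_mul_transpose]; exact hpos' _)
    (by rw [Matrix.mul_assoc]; exact (Matrix.rank_mul_le_left _ _).trans hA.le) hKp x
  have h3 : Aᵀ *ᵥ α = Aᵀ *ᵥ x := by
    have h4 : Aᵀ *ᵥ (α - x) = 0 := by
      apply mulVec_eq_zero_of_wNormSq_eq_zero hpos
      rw [wNormSq, Matrix.mulVec_sub, h1, sub_self, dotProduct_zero]
    rwa [Matrix.mulVec_sub, sub_eq_zero] at h4
  exact ⟨α, h3, by rwa [wNormSq_mul_mul_transpose, h3] at h2⟩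

/-- The normal equations are solved by the pseudo-inverse. -/
theorem mulVec_pinv_mulVec {S : Matrix (Fin p) (Fin p) ℝ} (hS : Sᵀ = S) {b : Fin p → ℝ}
    (hb : ∀ z, S *ᵥ z = 0 → z ⬝ᵥ b = 0) : S *ᵥ (pinv S *ᵥ b) = b := by
  have hP := isMoorePenrose_pinv S
  set r : Fin p → ℝ := b - S *ᵥ (pinv S *ᵥ b) with hr
  have hSr : S *ᵥ r = 0 := by
    have h1 : S * (S * pinv S) = S := by
      have := congrArg Matrix.transpose hP.mul_mul_self
      rwa [Matrix.transpose_mul, hP.symm_left, hS] at this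
    rw [hr, Matrix.mulVec_sub, Matrix.mulVec_mulVec, Matrix.mulVec_mulVec, Matrix.mul_assoc, h1, sub_self]
  -- The residual `r` lies in the kernel of `S`, hence is orthogonal both to `b` and to the range of
  -- the symmetric matrix `S`.
  have h2 : r ⬝ᵥ r = 0 := by
    conv_lhs => rw [hr, dotProduct_sub, ← hr]
    rw [hb r hSr, dotProduct_mulVec_transpose, hS, hSr, zero_dotProduct, sub_zero]
  have h3 := dotProduct_self_eq_zero.1 h2
  rw [hr, sub_eq_zero] at h3
  exact h3.symm

end LowRankPlusNoise

/-! ### Concentration of sums of squares of Gaussian variables -/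

/-- This is `-log (1 - t) ≤ t + t²`; at `t = 2θ` it controls the chi-square moment generating
function `(1 - 2θ)^(-1/2)`. -/
theorem one_le_one_sub_mul_exp {t : ℝ} (ht : |t| ≤ 1 / 2) : 1 ≤ (1 - t) * Real.exp (t + t ^ 2) := by
  obtain ⟨h1, h2⟩ := abs_le.1 ht
  rcases le_total 0 t with h | h
  · have h3 := Real.quadratic_le_exp_of_nonneg (x := t + t ^ 2) (by positivity)
    have h4 : 1 ≤ (1 - t) * (1 + (t + t ^ 2) + (t + t ^ 2) ^ 2 / 2) := by
      have : 0 ≤ t ^ 2 * (1 - t - t ^ 2 - t ^ 3) := by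
        apply mul_nonneg (sq_nonneg t)
        nlinarith [mul_nonneg h h, mul_nonneg (mul_nonneg h h) h]
      nlinarith
    exact h4.trans (mul_le_mul_of_nonneg_left h3 (by linarith))
  · have h3 := Real.add_one_le_exp (t + t ^ 2)
    have h4 : 1 ≤ (1 - t) * (t + t ^ 2 + 1) := by nlinarith [mul_nonneg (sq_nonneg t) (neg_nonneg.2 h)]
    exact h4.trans (mul_le_mul_of_nonneg_left h3 (by linarith))

theorem inv_sqrt_one_sub_le_exp {θ : ℝ} (h : |θ| ≤ 1 / 4) :
    (√(1 - 2 * θ))⁻¹ ≤ Real.exp (θ + 2 * θ ^ 2) := by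
  obtain ⟨h1, h2⟩ := abs_le.1 h
  have h3 := one_le_one_sub_mul_exp (t := 2 * θ) (abs_le.2 ⟨by linarith, by linarith⟩)
  have hpos : 0 < √(1 - 2 * θ) := Real.sqrt_pos.2 (by linarith)
  rw [inv_le_iff_one_le_mul₀ hpos]
  have h4 : Real.exp (2 * θ + (2 * θ) ^ 2) = Real.exp (θ + 2 * θ ^ 2) ^ 2 := by
    rw [← Real.exp_nat_mul]
    congr 1
    push_cast
    ring
  rw [h4, ← Real.sq_sqrt (show 0 ≤ 1 - 2 * θ by linarith), ← mul_pow] at h3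
  have := abs_le_of_sq_le_sq' (a := 1) (by rw [one_pow]; exact h3)
    (mul_nonneg hpos.le (Real.exp_pos _).le)
  linarith [this.2]

theorem gaussianPDFReal_mul_exp_sq {v : NNReal} (hv : v ≠ 0) (θ x : ℝ) :
    gaussianPDFReal 0 v x • Real.exp (θ / v * x ^ 2)
      = (√(2 * Real.pi * v))⁻¹ * Real.exp (-((1 - 2 * θ) / (2 * v)) * x ^ 2) := by
  have hv' : (v : ℝ) ≠ 0 := by exact_mod_cast hv
  rw [gaussianPDFReal, smul_eq_mul, mul_assoc, ← Real.exp_add]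
  congr 2
  field_simp
  ring

theorem integrable_exp_sq_gaussianReal {v : NNReal} (hv : v ≠ 0) {θ : ℝ} (hθ : θ < 1 / 2) :
    Integrable (fun x => Real.exp (θ / v * x ^ 2)) (gaussianReal 0 v) := by
  have hv' : (0 : ℝ) < v := by exact_mod_cast pos_iff_ne_zero.2 hv
  rw [gaussianReal_of_var_ne_zero _ hv, integrable_withDensity_iff_integrable_smul'
    (measurable_gaussianPDF 0 v) (ae_of_all _ fun x => gaussianPDF_lt_top)]
  simp_rw [toReal_gaussianPDF, gaussianPDFReal_mul_exp_sq hv]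
  exact (integrable_exp_neg_mul_sq (by apply div_pos <;> linarith)).const_mul _

theorem integral_exp_sq_gaussianReal_le {v : NNReal} (hv : v ≠ 0) {θ : ℝ} (hθ : |θ| ≤ 1 / 4) :
    ∫ x, Real.exp (θ / v * x ^ 2) ∂(gaussianReal 0 v) ≤ Real.exp (θ + 2 * θ ^ 2) := by
  have hv' : (0 : ℝ) < v := by exact_mod_cast pos_iff_ne_zero.2 hv
  obtain ⟨h1, h2⟩ := abs_le.1 hθ
  refine Eq.trans_le ?_ (inv_sqrt_one_sub_le_exp hθ)
  rw [integral_gaussianReal_eq_integral_smul hv]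
  simp_rw [gaussianPDFReal_mul_exp_sq hv]
  rw [integral_const_mul, integral_gaussian, ← Real.sqrt_inv, ← Real.sqrt_inv,
    ← Real.sqrt_mul (by positivity)]
  congr 1
  have : 1 - 2 * θ ≠ 0 := by linarith
  field_simp

theorem iIndepFun_integrable_exp_mul_sum₀ {Ω ι : Type*} [MeasurableSpace Ω] {μ : Measure Ω}
    {X : ι → Ω → ℝ} {t : ℝ} (hX : iIndepFun X μ) (hm : ∀ i, AEMeasurable (X i) μ) {s : Finset ι}
    (h : ∀ i ∈ s, Integrable (fun ω => Real.exp (t * X i ω)) μ) :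
    Integrable (fun ω => Real.exp (t * (∑ i ∈ s, X i) ω)) μ := by
  classical
  have : IsProbabilityMeasure μ := hX.isProbabilityMeasure
  induction s using Finset.induction_on with
  | empty => simp
  | insert i s hi ih =>
    rw [Finset.sum_insert hi]
    refine IndepFun.integrable_exp_mul_add ?_ (h i (Finset.mem_insert_self _ _))
      (ih fun j hj => h j (Finset.mem_insert_of_mem hj))
    exact (hX.indepFun_finsetSum_of_notMem₀ hm hi).symm

section Concentration

variable {Ω : Type*} [MeasurableSpace Ω] {μ : Measure Ω} {n : ℕ} {f : Fin n → Ω → ℝ} {v : NNReal}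

theorem mgf_sum_sq_le (hf : iIndepFun f μ) (hm : ∀ i, AEMeasurable (f i) μ)
    (hlaw : ∀ i, μ.map (f i) = gaussianReal 0 v) (hv : v ≠ 0) {θ : ℝ} (hθ : |θ| ≤ 1 / 4) :
    Integrable (fun ω => Real.exp (θ / v * (∑ i, fun ω => f i ω ^ 2) ω)) μ ∧
    mgf (∑ i, fun ω => f i ω ^ 2) μ (θ / v) ≤ Real.exp (n * (θ + 2 * θ ^ 2)) := by
  have : IsProbabilityMeasure μ := hf.isProbabilityMeasure
  have hind : iIndepFun (fun i ω => f i ω ^ 2) μ :=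
    hf.comp (fun _ x => x ^ 2) fun _ => by fun_prop
  have hm2 : ∀ i, AEMeasurable (fun ω => f i ω ^ 2) μ := fun i => (hm i).pow_const 2
  have hint : ∀ i, Integrable (fun ω => Real.exp (θ / v * f i ω ^ 2)) μ := by
    intro i
    have := integrable_exp_sq_gaussianReal hv (θ := θ) (by linarith [(abs_le.1 hθ).2])
    rw [← hlaw i] at this
    exact this.comp_aemeasurable (hm i)
  refine ⟨iIndepFun_integrable_exp_mul_sum₀ hind hm2 fun i _ => hint i, ?_⟩
  rw [hind.mgf_sum₀ hm2, Real.exp_nat_mul]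
  calc ∏ i, mgf (fun ω => f i ω ^ 2) μ (θ / v) ≤ ∏ _i : Fin n, Real.exp (θ + 2 * θ ^ 2) := by
        refine Finset.prod_le_prod (fun i _ => mgf_nonneg) fun i _ => ?_
        refine Eq.trans_le ?_ (integral_exp_sq_gaussianReal_le hv hθ)
        rw [← hlaw i, integral_map (hm i) (by fun_prop)]
        rfl
    _ = _ := by simp

/-- Two-sided tail bound for a sum of squares of independent centred Gaussian variables. -/
theorem measureReal_abs_sum_sq_sub_le (hf : iIndepFun f μ) (hm : ∀ i, AEMeasurable (f i) μ)
    (hlaw : ∀ i, μ.map (f i) = gaussianReal 0 v) {u : ℝ} (hu0 : 0 ≤ u) (hu1 : u ≤ 1) :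
    μ.real {ω | n * v * u < |∑ i, f i ω ^ 2 - n * v|} ≤ 2 * Real.exp (-(n * u ^ 2 / 8)) := by
  have : IsProbabilityMeasure μ := hf.isProbabilityMeasure
  rcases eq_or_ne v 0 with rfl | hv
  -- With zero variance the law is a point mass, and the strict inequality defining the event reads
  -- `0 < 0` almost surely.
  · have h0 : ∀ᵐ ω ∂μ, ∀ i, f i ω = 0 := by
      rw [ae_all_iff]
      intro i
      have : ∀ᵐ x ∂(μ.map (f i)), x = 0 := by
        rw [hlaw i, gaussianReal_zero_var, ae_dirac_eq, Filter.eventually_pure]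
      exact ae_of_ae_map (hm i) this
    have : μ {ω | n * ((0 : NNReal) : ℝ) * u < |∑ i, f i ω ^ 2 - n * ((0 : NNReal) : ℝ)|} = 0 := by
      rw [measure_eq_zero_iff_ae_notMem]
      filter_upwards [h0] with ω hω
      simp [hω]
    rw [measureReal_def, this]
    simp only [ENNReal.toReal_zero]
    positivity
  · have hv' : (0 : ℝ) < v := by exact_mod_cast pos_iff_ne_zero.2 hv
    set F : Ω → ℝ := ∑ i, fun ω => f i ω ^ 2 with hF
    have hFω : ∀ ω, F ω = ∑ i, f i ω ^ 2 := fun ω => by rw [hF, Finset.sum_apply]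
    have hsub : {ω | n * v * u < |∑ i, f i ω ^ 2 - n * v|}
        ⊆ {ω | n * v * (1 + u) ≤ F ω} ∪ {ω | F ω ≤ n * v * (1 - u)} := by
      intro ω hω
      simp only [Set.mem_ofPred_eq, Set.mem_union, hFω] at hω ⊢
      rcases lt_abs.1 hω with h | h
      · left; linarith
      · right; linarith
    -- The Chernoff exponent is `n (2θ² - θ u)`, minimal at `θ = u / 4` with value `-n u² / 8`; `u ≤
    -- 1` keeps `θ` in the admissible range.
    obtain ⟨i1, b1⟩ := mgf_sum_sq_le hf hm hlaw hv (θ := u / 4)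
      (abs_le.2 ⟨by linarith, by linarith⟩)
    obtain ⟨i2, b2⟩ := mgf_sum_sq_le hf hm hlaw hv (θ := -(u / 4))
      (abs_le.2 ⟨by linarith, by linarith⟩)
    have t1 := measure_ge_le_exp_mul_mgf (n * v * (1 + u)) (by positivity) i1
    have t2 := measure_le_le_exp_mul_mgf (n * v * (1 - u))
      (div_nonpos_of_nonpos_of_nonneg (by linarith) hv'.le) i2
    have c1 : μ.real {ω | n * v * (1 + u) ≤ F ω} ≤ Real.exp (-(n * u ^ 2 / 8)) := by
      refine t1.trans ((mul_le_mul_of_nonneg_left b1 (Real.exp_pos _).le).trans_eq ?_)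
      rw [← Real.exp_add]
      congr 1
      field_simp
      ring
    have c2 : μ.real {ω | F ω ≤ n * v * (1 - u)} ≤ Real.exp (-(n * u ^ 2 / 8)) := by
      refine t2.trans ((mul_le_mul_of_nonneg_left b2 (Real.exp_pos _).le).trans_eq ?_)
      rw [← Real.exp_add]
      congr 1
      field_simp
      ring
    calc _ ≤ _ := measureReal_mono hsub
      _ ≤ _ := measureReal_union_le _ _
      _ ≤ _ := by linarith

end Concentration

/-! ### A grid net for smallest singular values -/

/-- The grid `{z / m : z ∈ {-m, …, m}^K}`. -/
noncomputable def cubeGrid (K m : ℕ) : Finset (Fin K → ℝ) :=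
  (Fintype.piFinset fun _ : Fin K => Finset.Icc (-(m : ℤ)) m).image
    fun z k => (z k : ℝ) / m

theorem card_cubeGrid_le (K m : ℕ) : (cubeGrid K m).card ≤ (2 * m + 1) ^ K := by
  refine Finset.card_image_le.trans ?_
  rw [Fintype.card_piFinset]
  simp only [Int.card_Icc, Finset.prod_const, Finset.card_univ, Fintype.card_fin]
  gcongr
  omega

theorem single_mem_cubeGrid {K m : ℕ} (hm : 1 ≤ m) (k : Fin K) :
    (Pi.single k 1 : Fin K → ℝ) ∈ cubeGrid K m := by
  refine Finset.mem_image.2 ⟨Pi.single k (m : ℤ), ?_, ?_⟩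
  · rw [Fintype.mem_piFinset]
    intro j
    rw [Finset.mem_Icc]
    by_cases h : j = k
    · subst h; simp
    · simp [h]
  · funext j
    have : (m : ℝ) ≠ 0 := by positivity
    by_cases h : j = k
    · subst h; simp [this]
    · simp [h]

theorem exists_mem_cubeGrid_near {K m : ℕ} (hm : 1 ≤ m) (x : Fin K → ℝ) (hx : ∀ k, |x k| ≤ 1) :
    ∃ v ∈ cubeGrid K m, ∀ k, |x k - v k| ≤ 1 / m := by
  have hm' : (0 : ℝ) < m := by positivity
  refine ⟨fun k => (⌊m * x k⌋ : ℝ) / m, Finset.mem_image.2 ⟨fun k => ⌊m * x k⌋, ?_, rfl⟩, ?_⟩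
  · rw [Fintype.mem_piFinset]
    intro k
    obtain ⟨h1, h2⟩ := abs_le.1 (hx k)
    rw [Finset.mem_Icc, Int.le_floor, ← Int.lt_add_one_iff, Int.floor_lt]
    push_cast
    constructor <;> nlinarith
  · intro k
    have e : x k - (⌊m * x k⌋ : ℝ) / m = (m * x k - ⌊m * x k⌋) / m := by field_simp
    rw [e, abs_div, abs_of_pos hm', abs_of_nonneg (by linarith [Int.floor_le (m * x k)])]
    gcongr
    linarith [Int.lt_floor_add_one (m * x k)]

theorem mulVec_sq_le_sum_col_sq {n K : ℕ} (W : Matrix (Fin n) (Fin K) ℝ) (x : Fin K → ℝ) :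
    (W *ᵥ x) ⬝ᵥ (W *ᵥ x) ≤ (∑ k, (W *ᵥ Pi.single k 1) ⬝ᵥ (W *ᵥ Pi.single k 1)) * (x ⬝ᵥ x) := by
  simp only [dotProduct_self_eq_sum_sq, Matrix.mulVec_single_one, Matrix.col_apply]
  rw [Finset.sum_comm, Finset.sum_mul]
  exact Finset.sum_le_sum fun i _ =>
    Finset.sum_mul_sq_le_sq_mul_sq Finset.univ (W i) x

/-- A matrix whose quadratic form is nearly `c ‖v‖²` on a fine grid is bounded below everywhere. -/
theorem le_mulVec_sq_of_grid {n K m : ℕ} (hK : 1 ≤ K) (hm : m = 8 * K)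
    (W : Matrix (Fin n) (Fin K) ℝ) {c : ℝ} (hc : 0 ≤ c)
    (hW : ∀ v ∈ cubeGrid K m,
      |(W *ᵥ v) ⬝ᵥ (W *ᵥ v) - c * (v ⬝ᵥ v)| ≤ c * (v ⬝ᵥ v) * (1 / 2)) (x : Fin K → ℝ) :
    c / 5 * (x ⬝ᵥ x) ≤ (W *ᵥ x) ⬝ᵥ (W *ᵥ x) := by
  have hm1 : 1 ≤ m := by omega
  have hK' : (1 : ℝ) ≤ K := by exact_mod_cast hK
  have unit : ∀ x : Fin K → ℝ, x ⬝ᵥ x = 1 → c / 5 ≤ (W *ᵥ x) ⬝ᵥ (W *ᵥ x) := by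
    intro x hx
    have hx1 : ∀ k, |x k| ≤ 1 := by
      intro k
      rw [dotProduct_self_eq_sum_sq] at hx
      have : x k ^ 2 ≤ ∑ k, x k ^ 2 :=
        Finset.single_le_sum (f := fun k => x k ^ 2) (fun i _ => sq_nonneg _) (Finset.mem_univ k)
      rw [hx] at this
      exact abs_le_one_iff_mul_self_le_one.2 (by nlinarith)
    obtain ⟨v, hv, hnear⟩ := exists_mem_cubeGrid_near hm1 x hx1
    set d : Fin K → ℝ := x - v with hd
    -- Mesh `1 / (8K)` in each of `K` coordinates. The extra factor `1 / K` pays for the crude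
    -- Frobenius bound on `‖W d‖²` below.
    have hdd : d ⬝ᵥ d ≤ 1 / (64 * K) := by
      rw [dotProduct_self_eq_sum_sq]
      calc ∑ k, d k ^ 2 ≤ ∑ _k : Fin K, (1 / (m : ℝ)) ^ 2 := by
            refine Finset.sum_le_sum fun k _ => ?_
            rw [← sq_abs]
            exact pow_le_pow_left₀ (abs_nonneg _) (hnear k) 2
        _ = 1 / (64 * K) := by
            simp only [Finset.sum_const, Finset.card_univ, Fintype.card_fin, nsmul_eq_mul, hm]
            push_cast
            field_simp
            ring
    have hd0 := dotProduct_self_nonneg' d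
    have hdd' : d ⬝ᵥ d ≤ 1 / 64 := hdd.trans (by
      rw [div_le_div_iff₀ (by positivity) (by norm_num)]; linarith)
    -- The basis vectors belong to the grid, so each column of `W` has squared norm at most `3c/2`.
    have hWd : (W *ᵥ d) ⬝ᵥ (W *ᵥ d) ≤ c * (3 / 128) := by
      refine (mulVec_sq_le_sum_col_sq W d).trans ?_
      have h1 : ∑ k, (W *ᵥ Pi.single k 1) ⬝ᵥ (W *ᵥ Pi.single k 1) ≤ ∑ _k : Fin K, c * (3 / 2) := by
        refine Finset.sum_le_sum fun k _ => ?_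
        have h2 := (abs_le.1 (hW _ (single_mem_cubeGrid hm1 k))).2
        have h3 : (Pi.single k 1 : Fin K → ℝ) ⬝ᵥ Pi.single k 1 = 1 := by simp
        rw [h3] at h2
        linarith
      simp only [Finset.sum_const, Finset.card_univ, Fintype.card_fin, nsmul_eq_mul] at h1
      calc _ ≤ K * (c * (3 / 2)) * (1 / (64 * K)) :=
            mul_le_mul h1 hdd hd0 (by positivity)
        _ = c * (3 / 128) := by field_simp; ring
    -- `‖v‖² ≥ 3/4` and `‖W v‖² ≤ (1 + 1/3) ‖W x‖² + (1 + 3) ‖W d‖²`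
    have hvx : v = x - d := by rw [hd]; abel
    have hvv : 3 / 4 ≤ v ⬝ᵥ v := by
      have e : v ⬝ᵥ v = x ⬝ᵥ x - 2 * (x ⬝ᵥ d) + d ⬝ᵥ d := by
        rw [hvx, sub_dotProduct, dotProduct_sub x, dotProduct_sub d, dotProduct_comm d x]
        ring
      have h4 := dotProduct_sq_le x d
      rw [hx, one_mul] at h4
      have h5 : x ⬝ᵥ d ≤ 1 / 8 := by nlinarith
      rw [e, hx]
      nlinarith
    have hWv := (abs_le.1 (hW v hv)).1
    have e : (W *ᵥ v) ⬝ᵥ (W *ᵥ v) = (W *ᵥ x) ⬝ᵥ (W *ᵥ x) - 2 * ((W *ᵥ x) ⬝ᵥ (W *ᵥ d))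
        + (W *ᵥ d) ⬝ᵥ (W *ᵥ d) := by
      rw [hvx, Matrix.mulVec_sub, sub_dotProduct, dotProduct_sub, dotProduct_sub,
        dotProduct_comm (W *ᵥ d)]
      ring
    have h6 : 0 ≤ (W *ᵥ x + (3 : ℝ) • (W *ᵥ d)) ⬝ᵥ (W *ᵥ x + (3 : ℝ) • (W *ᵥ d)) :=
      dotProduct_self_nonneg' _
    simp only [add_dotProduct, dotProduct_add, smul_dotProduct, dotProduct_smul, smul_eq_mul] at h6
    rw [dotProduct_comm (W *ᵥ d) (W *ᵥ x)] at h6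
    -- In numbers: `‖W v‖² ≥ (c/2)(3/4) = 3c/8`, so `‖W x‖² ≥ (3/4)(3c/8 - 4 · 3c/128) = 27c/128 ≥
    -- c/5`.
    nlinarith
  by_cases hx : x ⬝ᵥ x = 0
  · rw [hx, mul_zero]; exact dotProduct_self_nonneg' _
  · have hx0 : 0 < x ⬝ᵥ x := lt_of_le_of_ne (dotProduct_self_nonneg' x) (Ne.symm hx)
    set r := √(x ⬝ᵥ x) with hr
    have hr0 : 0 < r := Real.sqrt_pos.2 hx0
    have hrr : r ^ 2 = x ⬝ᵥ x := Real.sq_sqrt hx0.le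
    have h1 := unit (r⁻¹ • x) (by
      rw [smul_dotProduct, dotProduct_smul, smul_eq_mul, smul_eq_mul, ← hrr]; field_simp)
    rw [Matrix.mulVec_smul, smul_dotProduct, dotProduct_smul, smul_eq_mul, smul_eq_mul] at h1
    rw [← hrr]
    calc c / 5 * r ^ 2 ≤ (r⁻¹ * (r⁻¹ * (W *ᵥ x ⬝ᵥ W *ᵥ x))) * r ^ 2 := by gcongr
      _ = _ := by field_simp

/-! ### Second moments in the factor regression model -/

section Moments

variable {Ω : Type*} [MeasurableSpace Ω] {P : Measure Ω} {d : ℕ} {V : Ω → Fin d → ℝ}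

theorem MeasureTheory.MemLp.dotProduct_const (hV : MemLp V 2 P) (u : Fin d → ℝ) :
    MemLp (fun ω => V ω ⬝ᵥ u) 2 P := by
  simp only [dotProduct]
  exact memLp_finsetSum _ fun i _ => (hV.eval i).mul_const _

theorem isHermitian_covMat (V : Ω → Fin d → ℝ) : (covMat V P).IsHermitian := by
  ext i j
  simp [covMat, covariance_comm]

variable [IsProbabilityMeasure P]

theorem integral_dotProduct_eq_zero (hV : MemLp V 2 P) (h0 : ∀ i, ∫ ω, V ω i ∂P = 0)
    (u : Fin d → ℝ) : ∫ ω, V ω ⬝ᵥ u ∂P = 0 := by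
  simp only [dotProduct]
  rw [integral_finsetSum _ fun i _ => ((hV.eval i).integrable (by norm_num)).mul_const _]
  exact Finset.sum_eq_zero fun i _ => by rw [integral_mul_const, h0, zero_mul]

theorem integral_dotProduct_mul_dotProduct (hV : MemLp V 2 P) (h0 : ∀ i, ∫ ω, V ω i ∂P = 0)
    (u w : Fin d → ℝ) :
    ∫ ω, (V ω ⬝ᵥ u) * (V ω ⬝ᵥ w) ∂P = u ⬝ᵥ (covMat V P *ᵥ w) := by
  have hint : ∀ i j, Integrable (fun ω => V ω i * V ω j) P := fun i j =>
    (hV.eval i).integrable_mul (hV.eval j)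
  have hcov : ∀ i j, covMat V P i j = ∫ ω, V ω i * V ω j ∂P := by
    intro i j
    rw [covMat, Matrix.of_apply, covariance_eq_sub (hV.eval i) (hV.eval j), h0 i, zero_mul,
      sub_zero]
    rfl
  have e : ∀ ω, (V ω ⬝ᵥ u) * (V ω ⬝ᵥ w) = ∑ i, ∑ j, (u i * w j) * (V ω i * V ω j) := by
    intro ω
    rw [dotProduct, dotProduct, Finset.sum_mul_sum]
    exact Finset.sum_congr rfl fun i _ => Finset.sum_congr rfl fun j _ => by ring
  simp_rw [e]
  rw [integral_finsetSum _ fun i _ => integrable_finsetSum _ fun j _ => (hint i j).const_mul _]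
  rw [dotProduct]
  refine Finset.sum_congr rfl fun i _ => ?_
  rw [integral_finsetSum _ fun j _ => (hint i j).const_mul _, Matrix.mulVec, dotProduct,
    Finset.mul_sum]
  refine Finset.sum_congr rfl fun j _ => ?_
  rw [integral_const_mul, hcov]
  ring

theorem wNormSq_covMat_nonneg (hV : MemLp V 2 P) (h0 : ∀ i, ∫ ω, V ω i ∂P = 0)
    (x : Fin d → ℝ) : 0 ≤ wNormSq (covMat V P) x := by
  rw [wNormSq, ← integral_dotProduct_mul_dotProduct hV h0]
  exact integral_nonneg fun ω => mul_self_nonneg _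

end Moments

theorem transpose_eq_of_isHermitian {d : ℕ} {Q : Matrix (Fin d) (Fin d) ℝ}
    (hQ : Q.IsHermitian) : Qᵀ = Q := by
  rw [← Matrix.conjTranspose_eq_transpose_of_trivial]
  exact hQ

theorem dotProduct_mulVec_comm {d : ℕ} {Q : Matrix (Fin d) (Fin d) ℝ} (hQ : Q.IsHermitian)
    (x y : Fin d → ℝ) : x ⬝ᵥ (Q *ᵥ y) = y ⬝ᵥ (Q *ᵥ x) := by
  rw [dotProduct_mulVec_transpose, transpose_eq_of_isHermitian hQ, dotProduct_comm]

theorem wNormSq_sub {d : ℕ} {Q : Matrix (Fin d) (Fin d) ℝ} (hQ : Q.IsHermitian)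
    (x y : Fin d → ℝ) : wNormSq Q (x - y) = wNormSq Q x - 2 * (x ⬝ᵥ (Q *ᵥ y)) + wNormSq Q y := by
  unfold wNormSq
  rw [Matrix.mulVec_sub, dotProduct_sub, sub_dotProduct, sub_dotProduct,
    dotProduct_mulVec_comm hQ y x]
  ring

namespace FactorModel

variable {Ω : Type*} [MeasurableSpace Ω] {P : Measure Ω} {p K : ℕ} (M : FactorModel P p K)

theorem X_dotProduct (ω : Ω) (α : Fin p → ℝ) :
    M.X ω ⬝ᵥ α = M.Z ω ⬝ᵥ (M.Aᵀ *ᵥ α) + M.E ω ⬝ᵥ α := by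
  rw [X, add_dotProduct, dotProduct_mulVec_transpose, Matrix.transpose_transpose]

theorem memLp_X : MemLp M.X 2 P := by
  refine MemLp.add ?_ M.memLp_E
  exact memLp_pi_iff.2 fun i => by
    simpa only [Matrix.mulVec, dotProduct_comm] using M.memLp_Z.dotProduct_const (M.A i)

theorem noiseVar_nonneg : 0 ≤ M.noiseVar := variance_nonneg _ _

theorem le_height (hM : M.FullRank) : K ≤ p := by
  have := M.A.rank_le_height
  rwa [hM.1] at this

theorem snr_inv_mul_opNorm (s : ℝ) (hs : s = opNorm M.covE) :
    M.snr⁻¹ * s = s ^ 2 / ordEig (M.A * M.covZ * M.Aᵀ) K := by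
  rw [snr, ← hs, inv_div]
  ring

theorem isHermitian_covX : M.covX.IsHermitian := isHermitian_covMat _

theorem isHermitian_covE : M.covE.IsHermitian := isHermitian_covMat _

theorem isHermitian_covZ : M.covZ.IsHermitian := isHermitian_covMat _

theorem one_le_condNumber (hp : 1 ≤ p) (hE : 0 < ordEig M.covE p) : 1 ≤ condNumber M.covE := by
  rw [condNumber, one_le_div hE]
  exact ordEig_antitone M.isHermitian_covE le_rfl hp le_rfl

variable [IsProbabilityMeasure P]

/-- The one second-moment computation of the model: cross terms vanish by independence and centring.
`Σ_X`, `Σ_{Xy}` and the risk follow by choosing coefficients. -/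
theorem integral_linear_mul_linear (u u' : Fin K → ℝ) (v v' : Fin p → ℝ) (s s' : ℝ) :
    ∫ ω, (M.Z ω ⬝ᵥ u + M.E ω ⬝ᵥ v + s * M.ε ω) * (M.Z ω ⬝ᵥ u' + M.E ω ⬝ᵥ v' + s' * M.ε ω) ∂P
      = u ⬝ᵥ (M.covZ *ᵥ u') + v ⬝ᵥ (M.covE *ᵥ v') + s * s' * M.noiseVar := by
  have hZ : ∀ u, MemLp (fun ω => M.Z ω ⬝ᵥ u) 2 P := M.memLp_Z.dotProduct_const
  have hE : ∀ u, MemLp (fun ω => M.E ω ⬝ᵥ u) 2 P := M.memLp_E.dotProduct_const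
  have hε := M.memLp_ε
  have hZ0 := integral_dotProduct_eq_zero M.memLp_Z M.mean_Z
  have cZE : ∀ u v, ∫ ω, (M.Z ω ⬝ᵥ u) * (M.E ω ⬝ᵥ v) ∂P = 0 := by
    intro u v
    have h : IndepFun (fun ω => M.Z ω ⬝ᵥ u) (fun ω => M.E ω ⬝ᵥ v) P :=
      M.indep_Z.comp (φ := fun z => z ⬝ᵥ u) (ψ := fun q : (Fin p → ℝ) × ℝ => q.1 ⬝ᵥ v)
        (by unfold dotProduct; fun_prop) (by unfold dotProduct; fun_prop)
    rw [h.integral_fun_mul_eq_mul_integral (hZ u).1 (hE v).1, hZ0, zero_mul]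
  have cZε : ∀ u, ∫ ω, (M.Z ω ⬝ᵥ u) * M.ε ω ∂P = 0 := by
    intro u
    have h : IndepFun (fun ω => M.Z ω ⬝ᵥ u) M.ε P :=
      M.indep_Z.comp (φ := fun z => z ⬝ᵥ u) (ψ := fun q : (Fin p → ℝ) × ℝ => q.2)
        (by unfold dotProduct; fun_prop) measurable_snd
    rw [h.integral_fun_mul_eq_mul_integral (hZ u).1 hε.1, hZ0, zero_mul]
  have cEε : ∀ v, ∫ ω, (M.E ω ⬝ᵥ v) * M.ε ω ∂P = 0 := by
    intro v
    have h : IndepFun (fun ω => M.E ω ⬝ᵥ v) M.ε P :=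
      M.indep_E.comp (φ := fun z => z ⬝ᵥ v) (ψ := id)
        (by unfold dotProduct; fun_prop) measurable_id
    rw [h.integral_fun_mul_eq_mul_integral (hE v).1 hε.1, M.mean_ε, mul_zero]
  have hvar : ∫ ω, M.ε ω * M.ε ω ∂P = M.noiseVar := by
    rw [noiseVar, variance_of_integral_eq_zero hε.1.aemeasurable M.mean_ε]
    exact integral_congr_ae (ae_of_all _ fun ω => by simp [sq])
  have e : ∀ ω, (M.Z ω ⬝ᵥ u + M.E ω ⬝ᵥ v + s * M.ε ω) * (M.Z ω ⬝ᵥ u' + M.E ω ⬝ᵥ v' + s' * M.ε ω)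
      = (M.Z ω ⬝ᵥ u) * (M.Z ω ⬝ᵥ u') + ((M.E ω ⬝ᵥ v) * (M.E ω ⬝ᵥ v')
        + (s * s' * (M.ε ω * M.ε ω) + ((M.Z ω ⬝ᵥ u) * (M.E ω ⬝ᵥ v')
        + ((M.Z ω ⬝ᵥ u') * (M.E ω ⬝ᵥ v) + (s' * ((M.Z ω ⬝ᵥ u) * M.ε ω)
        + (s * ((M.Z ω ⬝ᵥ u') * M.ε ω) + (s' * ((M.E ω ⬝ᵥ v) * M.ε ω)
        + s * ((M.E ω ⬝ᵥ v') * M.ε ω)))))))) := fun ω => by ring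
  simp_rw [e]
  have i1 : Integrable (fun ω => (M.Z ω ⬝ᵥ u) * (M.Z ω ⬝ᵥ u')) P := (hZ u).integrable_mul (hZ u')
  have i2 : Integrable (fun ω => (M.E ω ⬝ᵥ v) * (M.E ω ⬝ᵥ v')) P := (hE v).integrable_mul (hE v')
  have i3 : Integrable (fun ω => s * s' * (M.ε ω * M.ε ω)) P := (hε.integrable_mul hε).const_mul _
  have i4 : ∀ u v, Integrable (fun ω => (M.Z ω ⬝ᵥ u) * (M.E ω ⬝ᵥ v)) P := fun u v =>
    (hZ u).integrable_mul (hE v)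
  have i5 : ∀ u (c : ℝ), Integrable (fun ω => c * ((M.Z ω ⬝ᵥ u) * M.ε ω)) P := fun u c =>
    ((hZ u).integrable_mul hε).const_mul c
  have i6 : ∀ u (c : ℝ), Integrable (fun ω => c * ((M.E ω ⬝ᵥ u) * M.ε ω)) P := fun u c =>
    ((hE u).integrable_mul hε).const_mul c
  have j7 := (i6 v s').fun_add (i6 v' s)
  have j6 := (i5 u' s).fun_add j7
  have j5 := (i5 u s').fun_add j6
  have j4 := (i4 u' v).fun_add j5
  have j3 := (i4 u v').fun_add j4
  have j2 := i3.fun_add j3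
  have j1 := i2.fun_add j2
  rw [integral_add i1 j1, integral_add i2 j2, integral_add i3 j3, integral_add (i4 u v') j4,
    integral_add (i4 u' v) j5, integral_add (i5 u s') j6, integral_add (i5 u' s) j7,
    integral_add (i6 v s') (i6 v' s)]
  simp only [integral_const_mul, cZE, cZε, cEε, hvar]
  rw [integral_dotProduct_mul_dotProduct M.memLp_Z M.mean_Z,
    integral_dotProduct_mul_dotProduct M.memLp_E M.mean_E, covZ, covE]
  ring

theorem mean_X (j : Fin p) : ∫ ω, M.X ω j ∂P = 0 := by
  have e : ∀ ω, M.X ω j = M.Z ω ⬝ᵥ M.A j + M.E ω j := fun ω => by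
    rw [X, Pi.add_apply, Matrix.mulVec, dotProduct_comm]
  simp_rw [e]
  rw [integral_add ((M.memLp_Z.dotProduct_const _).integrable (by norm_num))
    ((M.memLp_E.eval j).integrable (by norm_num)),
    integral_dotProduct_eq_zero M.memLp_Z M.mean_Z, M.mean_E, zero_add]

theorem covX_eq : M.covX = M.A * M.covZ * M.Aᵀ + M.covE := by
  have key : ∀ u w : Fin p → ℝ,
      u ⬝ᵥ (M.covX *ᵥ w) = u ⬝ᵥ ((M.A * M.covZ * M.Aᵀ + M.covE) *ᵥ w) := by
    intro u w
    rw [covX, ← integral_dotProduct_mul_dotProduct M.memLp_X M.mean_X]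
    have := M.integral_linear_mul_linear (M.Aᵀ *ᵥ u) (M.Aᵀ *ᵥ w) u w 0 0
    simp only [zero_mul, add_zero] at this
    simp_rw [X_dotProduct]
    rw [this, Matrix.add_mulVec, dotProduct_add, ← Matrix.mulVec_mulVec, ← Matrix.mulVec_mulVec,
      dotProduct_mulVec_transpose M.A]
  ext i j
  simpa using key (Pi.single i 1) (Pi.single j 1)

theorem dotProduct_covXy (x : Fin p → ℝ) :
    x ⬝ᵥ M.covXy = x ⬝ᵥ (M.A *ᵥ (M.covZ *ᵥ M.β)) := by
  have hy : MemLp M.y 2 P := (M.memLp_Z.dotProduct_const _).add M.memLp_ε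
  have h1 : x ⬝ᵥ M.covXy = ∫ ω, (M.X ω ⬝ᵥ x) * M.y ω ∂P := by
    have e : ∀ ω, (M.X ω ⬝ᵥ x) * M.y ω = ∑ j, x j * (M.X ω j * M.y ω) := by
      intro ω
      rw [dotProduct, Finset.sum_mul]
      exact Finset.sum_congr rfl fun j _ => by ring
    simp_rw [e]
    have hint : ∀ j, Integrable (fun ω => M.X ω j * M.y ω) P := fun j =>
      (M.memLp_X.eval j).integrable_mul hy
    rw [integral_finsetSum _ fun j _ => (hint j).const_mul _]
    simp_rw [integral_const_mul]
    rfl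
  have h2 := M.integral_linear_mul_linear (M.Aᵀ *ᵥ x) M.β x 0 0 1
  simp only [zero_mul, add_zero, one_mul, dotProduct_zero, Matrix.mulVec_zero] at h2
  rw [h1]
  simp_rw [X_dotProduct, y]
  rw [h2, dotProduct_mulVec_transpose M.A]

theorem covXy_eq : M.covXy = M.A *ᵥ (M.covZ *ᵥ M.β) := by
  funext j
  simpa using M.dotProduct_covXy (Pi.single j 1)

theorem wNormSq_covX_nonneg (x : Fin p → ℝ) : 0 ≤ wNormSq M.covX x :=
  wNormSq_covMat_nonneg M.memLp_X M.mean_X x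

theorem wNormSq_covE_nonneg (x : Fin p → ℝ) : 0 ≤ wNormSq M.covE x :=
  wNormSq_covMat_nonneg M.memLp_E M.mean_E x

theorem wNormSq_covZ_nonneg (x : Fin K → ℝ) : 0 ≤ wNormSq M.covZ x :=
  wNormSq_covMat_nonneg M.memLp_Z M.mean_Z x

theorem wNormSq_covX (x : Fin p → ℝ) :
    wNormSq M.covX x = wNormSq M.covZ (M.Aᵀ *ᵥ x) + wNormSq M.covE x := by
  rw [covX_eq, wNormSq_add, wNormSq_mul_mul_transpose]

/-! ### Population risk: best linear predictor, its projection, and the noise level. -/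

theorem risk_eq (α : Fin p → ℝ) :
    M.risk α = wNormSq M.covZ (M.Aᵀ *ᵥ α - M.β) + wNormSq M.covE α + M.noiseVar := by
  have h := M.integral_linear_mul_linear (M.Aᵀ *ᵥ α - M.β) (M.Aᵀ *ᵥ α - M.β) α α (-1) (-1)
  rw [risk, wNormSq, wNormSq]
  refine Eq.trans (integral_congr_ae (ae_of_all _ fun ω => ?_)) (h.trans (by ring))
  simp only [X_dotProduct, y, dotProduct_sub]
  ring

theorem wNormSq_covZ_pos (hM : M.FullRank) {x : Fin K → ℝ} (hx : x ≠ 0) :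
    0 < wNormSq M.covZ x :=
  wNormSq_pos_of_rank M.isHermitian_covZ M.wNormSq_covZ_nonneg hM.2 hx

theorem transpose_mulVec_eq_zero_of_wNormSq_covX (hM : M.FullRank) {z : Fin p → ℝ}
    (hz : wNormSq M.covX z = 0) : M.Aᵀ *ᵥ z = 0 := by
  by_contra h
  have h1 := M.wNormSq_covZ_pos hM h
  have h2 := M.wNormSq_covE_nonneg z
  rw [wNormSq_covX] at hz
  linarith

/-- The normal equations hold although `Σ_X` may be singular: its kernel lies in `ker Aᵀ`, hence is
orthogonal to `Σ_{Xy} = A Σ_Z β`. -/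
theorem covX_mulVec_bestLinear (hM : M.FullRank) :
    M.covX *ᵥ M.bestLinear = M.A *ᵥ (M.covZ *ᵥ M.β) := by
  rw [bestLinear, mulVec_pinv_mulVec (transpose_eq_of_isHermitian M.isHermitian_covX), covXy_eq]
  intro z hz
  have h := M.transpose_mulVec_eq_zero_of_wNormSq_covX hM (z := z)
    (by rw [wNormSq, hz, dotProduct_zero])
  rw [covXy_eq, dotProduct_mulVec_transpose, h, zero_dotProduct]

/-- The excess risk over the best linear predictor is a squared distance. -/
theorem risk_eq_risk_bestLinear_add (hM : M.FullRank) (α : Fin p → ℝ) :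
    M.risk α = M.risk M.bestLinear + wNormSq M.covX (α - M.bestLinear) := by
  have key : ∀ α, M.risk α
      = wNormSq M.covX α - 2 * (α ⬝ᵥ (M.covX *ᵥ M.bestLinear)) + wNormSq M.covZ M.β
        + M.noiseVar := by
    intro α
    rw [risk_eq, wNormSq_sub M.isHermitian_covZ, wNormSq_covX, M.covX_mulVec_bestLinear hM,
      dotProduct_mulVec_transpose M.A]
    ring
  rw [key α, key M.bestLinear, wNormSq_sub M.isHermitian_covX]
  unfold wNormSq
  ring

theorem noiseVar_le_risk (α : Fin p → ℝ) : M.noiseVar ≤ M.risk α := by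
  rw [risk_eq]
  linarith [M.wNormSq_covE_nonneg α, M.wNormSq_covZ_nonneg (M.Aᵀ *ᵥ α - M.β)]

theorem risk_bestLinear_le (hM : M.FullRank) (α : Fin p → ℝ) : M.risk M.bestLinear ≤ M.risk α := by
  rw [M.risk_eq_risk_bestLinear_add hM α]
  linarith [M.wNormSq_covX_nonneg (α - M.bestLinear)]

theorem ordEig_signal_pos (hM : M.FullRank) (hK : 1 ≤ K) :
    0 < ordEig (M.A * M.covZ * M.Aᵀ) K := by
  have hKp : K ≤ p := by
    have := M.A.rank_le_height
    rw [hM.1] at this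
    exact this
  have h := ordEig_pos_of_le_rank (isHermitian_mul_mul_transpose (A := M.A) M.isHermitian_covZ)
    (fun x => by rw [wNormSq_mul_mul_transpose]; exact M.wNormSq_covZ_nonneg _)
    (le_rank_of_wNormSq_ker hM.1
      fun z hz => mulVec_eq_zero_of_wNormSq_eq_zero (fun x hx => M.wNormSq_covZ_pos hM hx) hz)
    ⟨K - 1, by omega⟩ (by simp; omega)
  simpa [Nat.sub_add_cancel hK] using h

theorem ordEig_covX_pos (hM : M.FullRank) (k : Fin K) : 0 < ordEig M.covX ((k : ℕ) + 1) :=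
  ordEig_pos_of_le_rank M.isHermitian_covX M.wNormSq_covX_nonneg
    (le_rank_of_wNormSq_ker hM.1 fun _ hz => M.transpose_mulVec_eq_zero_of_wNormSq_covX hM hz)
    ⟨k, by have := M.le_height hM; omega⟩ k.2

/-- Outside the span of the top `K` eigenvectors the feature covariance is noise. -/
theorem wNormSq_covX_le_of_orthogonal (hM : M.FullRank) {U : Matrix (Fin p) (Fin K) ℝ}
    (hU : IsTopEigenvectors M.covX U) (x : Fin p → ℝ) (hx : Uᵀ *ᵥ x = 0) :
    wNormSq M.covX x ≤ opNorm M.covE * (x ⬝ᵥ x) := by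
  refine hU.wNormSq_le_of_orthogonal M.isHermitian_covX (M.le_height hM) (fun j hj => ?_) x hx
  -- On `ker Aᵀ` the signal part of `Σ_X` vanishes and only `Σ_E` is left.
  refine ordEig_le_of_wNormSq_le_on_ker M.isHermitian_covX (A := M.A) (fun z hz => ?_) j hj
  rw [wNormSq_covX, hz]
  have : wNormSq M.covZ 0 = 0 := by rw [wNormSq, zero_dotProduct]
  rw [this, zero_add]
  exact wNormSq_le_opNorm_mul _ _

/-- The risk of the projection of the best linear predictor onto the top eigenvectors. -/
theorem risk_projection_le (hM : M.FullRank) {U : Matrix (Fin p) (Fin K) ℝ}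
    (hU : IsTopEigenvectors M.covX U) :
    M.risk (U *ᵥ (Uᵀ *ᵥ M.bestLinear)) ≤ M.risk M.bestLinear
      + opNorm M.covE * (M.bestLinear ⬝ᵥ M.bestLinear) := by
  set a := M.bestLinear with ha
  set b := U *ᵥ (Uᵀ *ᵥ a) with hb
  have h0 : Uᵀ *ᵥ (b - a) = 0 := by
    rw [hb, Matrix.mulVec_sub, Matrix.mulVec_mulVec, hU.orthonormal, Matrix.one_mulVec, sub_self]
  rw [M.risk_eq_risk_bestLinear_add hM b]
  have h1 := M.wNormSq_covX_le_of_orthogonal hM hU (b - a) h0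
  have h2 : (b - a) ⬝ᵥ (b - a) ≤ a ⬝ᵥ a := by
    have h3 : b ⬝ᵥ (b - a) = 0 := by
      conv_lhs => rw [dotProduct_comm, hb, dotProduct_mulVec_transpose, ← hb, h0, zero_dotProduct]
    have h4 : b ⬝ᵥ b = b ⬝ᵥ a := by
      rw [dotProduct_sub] at h3; linarith
    have h5 : (b - a) ⬝ᵥ (b - a) = a ⬝ᵥ a - b ⬝ᵥ b := by
      rw [sub_dotProduct, h3, dotProduct_sub, dotProduct_comm a b, h4]; ring
    rw [h5]
    linarith [dotProduct_self_nonneg' b]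
  linarith [mul_le_mul_of_nonneg_left h2 (opNorm_nonneg M.covE)]

/-- The risk of the best linear predictor exceeds the noise level by the feature noise. -/
theorem risk_bestLinear_sub_noiseVar_le (hM : M.FullRank) (hK : 1 ≤ K) :
    M.risk M.bestLinear - M.noiseVar
      ≤ (1 + M.snr⁻¹) * opNorm M.covE * (M.bestLinear ⬝ᵥ M.bestLinear) := by
  set a := M.bestLinear with ha
  set s := opNorm M.covE with hs
  have hl := M.ordEig_signal_pos hM hK
  set l := ordEig (M.A * M.covZ * M.Aᵀ) K with hldef
  have hnormal := M.covX_mulVec_bestLinear hM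
  set w := M.Aᵀ *ᵥ a - M.β with hw
  -- The normal equations, rearranged: the latent misfit `w` is balanced by `Σ_E α*`, and `λ_K`
  -- converts this into a bound on `w`.
  have h1 : M.A *ᵥ (M.covZ *ᵥ w) = -(M.covE *ᵥ a) := by
    rw [covX_eq, Matrix.add_mulVec, ← Matrix.mulVec_mulVec, ← Matrix.mulVec_mulVec] at hnormal
    rw [hw, Matrix.mulVec_sub, Matrix.mulVec_sub, ← hnormal, ← ha]
    abel
  have h2 := ordEig_mul_wNormSq_le_sq hM.1 M.isHermitian_covZ M.wNormSq_covZ_nonneg w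
  rw [h1, neg_dotProduct_neg, ← hldef] at h2
  have h3 := mulVec_sq_le_opNorm_sq M.covE a
  rw [← hs] at h3
  have h4 : wNormSq M.covZ w ≤ s ^ 2 / l * (a ⬝ᵥ a) := by
    rw [div_mul_eq_mul_div, le_div_iff₀ hl]
    linarith
  rw [risk_eq, add_mul, one_mul, M.snr_inv_mul_opNorm s hs, add_mul]
  have h5 := wNormSq_le_opNorm_mul M.covE a
  rw [← hs] at h5
  linarith

/-- Compare with a small solution of `Aᵀ α = β`, whose excess risk is just `‖α‖²` in the norm of
`Σ_E`. If `Σ_E = 0`, division by zero makes the right side `0`, which is still correct. -/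
theorem risk_bestLinear_sub_noiseVar_le_snr (hM : M.FullRank) (hK : 1 ≤ K) :
    M.risk M.bestLinear - M.noiseVar ≤ wNormSq M.covZ M.β / M.snr := by
  obtain ⟨α, h1, h2⟩ := exists_transpose_mulVec_eq_and_le hM.1 M.isHermitian_covZ
    (fun x hx => M.wNormSq_covZ_pos hM hx) M.β
  have hl := M.ordEig_signal_pos hM hK
  have h3 := M.risk_bestLinear_le hM α
  have h4 : wNormSq M.covZ (M.Aᵀ *ᵥ α - M.β) = 0 := by
    rw [h1, sub_self, wNormSq, zero_dotProduct]
  rw [M.risk_eq α, h4, zero_add] at h3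
  have h5 := wNormSq_le_opNorm_mul M.covE α
  have h6 : opNorm M.covE * (α ⬝ᵥ α) ≤ wNormSq M.covZ M.β / M.snr := by
    rw [snr, div_div_eq_mul_div, le_div_iff₀ hl]
    nlinarith [mul_le_mul_of_nonneg_left h2 (opNorm_nonneg M.covE)]
  linarith

theorem snr_nonneg (hM : M.FullRank) (hK : 1 ≤ K) : 0 ≤ M.snr :=
  div_nonneg (M.ordEig_signal_pos hM hK).le (opNorm_nonneg _)

/-- The term `‖α*‖²` weighted by `Σ_E` is part of `R(α*) - σ_ε²` and is at least `λ_p(Σ_E) ‖α*‖²`.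
-/
theorem opNorm_mul_bestLinear_sq_le (hM : M.FullRank) (hK : 1 ≤ K)
    (hE : 0 < ordEig M.covE p) :
    opNorm M.covE * (M.bestLinear ⬝ᵥ M.bestLinear)
      ≤ condNumber M.covE * (wNormSq M.covZ M.β / M.snr) := by
  have hp : 1 ≤ p := hK.trans (M.le_height hM)
  have h1 := opNorm_le_ordEig_one M.isHermitian_covE M.wNormSq_covE_nonneg hp
  have h2 := ordEig_last_mul_le_wNormSq M.isHermitian_covE M.bestLinear
  have h3 := M.risk_bestLinear_sub_noiseVar_le_snr hM hK
  rw [risk_eq] at h3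
  have h4 := M.wNormSq_covZ_nonneg (M.Aᵀ *ᵥ M.bestLinear - M.β)
  have h5 : ordEig M.covE p * (M.bestLinear ⬝ᵥ M.bestLinear) ≤ wNormSq M.covZ M.β / M.snr := by
    linarith
  have h6 : 0 ≤ ordEig M.covE 1 := (opNorm_nonneg _).trans h1
  rw [condNumber, div_mul_eq_mul_div, le_div_iff₀ hE]
  calc _ ≤ ordEig M.covE 1 * (M.bestLinear ⬝ᵥ M.bestLinear) * ordEig M.covE p := by
        gcongr
        exact dotProduct_self_nonneg' _
    _ = ordEig M.covE 1 * (ordEig M.covE p * (M.bestLinear ⬝ᵥ M.bestLinear)) := by ring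
    _ ≤ _ := mul_le_mul_of_nonneg_left h5 h6

end FactorModel

namespace FactorModel

variable {Ω : Type*} [MeasurableSpace Ω] {P : Measure Ω} {p K : ℕ} (M : FactorModel P p K)

/-! ### The estimator given the sample -/

/-- The directions in which the features have unit variance: `U Λ^{-1/2} v`. -/
noncomputable def whiten (U : Matrix (Fin p) (Fin K) ℝ) (v : Fin K → ℝ) : Fin p → ℝ :=
  U *ᵥ fun k => v k / √(ordEig M.covX ((k : ℕ) + 1))

theorem covX_mulVec_mulVec {U : Matrix (Fin p) (Fin K) ℝ} (hU : IsTopEigenvectors M.covX U)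
    (c : Fin K → ℝ) :
    M.covX *ᵥ (U *ᵥ c) = U *ᵥ fun k : Fin K => ordEig M.covX ((k : ℕ) + 1) * c k := by
  rw [Matrix.mulVec_mulVec, hU.eigen, ← Matrix.mulVec_mulVec]
  congr 1
  funext k
  rw [Matrix.mulVec_diagonal]

theorem wNormSq_covX_mulVec {U : Matrix (Fin p) (Fin K) ℝ} (hU : IsTopEigenvectors M.covX U)
    (c : Fin K → ℝ) :
    wNormSq M.covX (U *ᵥ c) = ∑ k : Fin K, ordEig M.covX ((k : ℕ) + 1) * c k ^ 2 := by
  rw [wNormSq, M.covX_mulVec_mulVec hU, mulVec_dotProduct_mulVec, hU.orthonormal,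
    Matrix.one_mulVec, dotProduct]
  exact Finset.sum_congr rfl fun k _ => by ring

theorem mul_mul_diagonal_mulVec {n : ℕ} (X : Matrix (Fin n) (Fin p) ℝ)
    (U : Matrix (Fin p) (Fin K) ℝ) (v : Fin K → ℝ) :
    (X * U * Matrix.diagonal fun k : Fin K => (√(ordEig M.covX ((k : ℕ) + 1)))⁻¹) *ᵥ v
      = X *ᵥ M.whiten U v := by
  rw [whiten, ← Matrix.mulVec_mulVec, ← Matrix.mulVec_mulVec]
  congr 2
  funext k
  rw [Matrix.mulVec_diagonal, div_eq_inv_mul]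

variable [IsProbabilityMeasure P]

theorem wNormSq_covX_whiten (hM : M.FullRank) {U : Matrix (Fin p) (Fin K) ℝ}
    (hU : IsTopEigenvectors M.covX U) (v : Fin K → ℝ) :
    wNormSq M.covX (M.whiten U v) = v ⬝ᵥ v := by
  rw [whiten, M.wNormSq_covX_mulVec hU, dotProduct_self_eq_sum_sq]
  refine Finset.sum_congr rfl fun k _ => ?_
  have h := M.ordEig_covX_pos hM k
  rw [div_pow, Real.sq_sqrt h.le]
  field_simp

/-- Pythagoras: `Σ_X` preserves the span of the eigenvectors, and `α* - U Uᵀ α*` is orthogonal to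
it, so the cross term vanishes. -/
theorem risk_mulVec (hM : M.FullRank) {U : Matrix (Fin p) (Fin K) ℝ}
    (hU : IsTopEigenvectors M.covX U) (c : Fin K → ℝ) :
    M.risk (U *ᵥ c) = M.risk (U *ᵥ (Uᵀ *ᵥ M.bestLinear))
      + wNormSq M.covX (U *ᵥ (c - Uᵀ *ᵥ M.bestLinear)) := by
  rw [M.risk_eq_risk_bestLinear_add hM, M.risk_eq_risk_bestLinear_add hM (U *ᵥ (Uᵀ *ᵥ _))]
  set a := M.bestLinear
  set b := U *ᵥ (Uᵀ *ᵥ a) with hb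
  have h0 : Uᵀ *ᵥ (a - b) = 0 := by
    rw [hb, Matrix.mulVec_sub, Matrix.mulVec_mulVec, hU.orthonormal, Matrix.one_mulVec, sub_self]
  have e : U *ᵥ c - a = U *ᵥ (c - Uᵀ *ᵥ a) - (a - b) := by
    rw [Matrix.mulVec_sub, ← hb]; abel
  have e' : wNormSq M.covX (b - a) = wNormSq M.covX (a - b) := by
    rw [← neg_sub a b, wNormSq, wNormSq, Matrix.mulVec_neg, neg_dotProduct_neg]
  rw [e, e', wNormSq_sub M.isHermitian_covX, dotProduct_mulVec_comm M.isHermitian_covX,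
    M.covX_mulVec_mulVec hU, dotProduct_mulVec_transpose U, h0, zero_dotProduct]
  ring

/-- Population form of the uncorrelatedness of residual and whitened features; its empirical version
at `v = ± τ e_k` bounds the sample correlations. -/
theorem risk_projection_add_whiten (hM : M.FullRank) {U : Matrix (Fin p) (Fin K) ℝ}
    (hU : IsTopEigenvectors M.covX U) (v : Fin K → ℝ) :
    M.risk (U *ᵥ (Uᵀ *ᵥ M.bestLinear) + M.whiten U v)
      = M.risk (U *ᵥ (Uᵀ *ᵥ M.bestLinear)) + v ⬝ᵥ v := by
  rw [whiten, ← Matrix.mulVec_add, M.risk_mulVec hM hU, add_sub_cancel_left,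
    ← M.wNormSq_covX_whiten hM hU, whiten]

/-- Risk bound for principal components regression on a sample whose whitened features are well
conditioned and nearly uncorrelated with the residuals. -/
theorem risk_pcrEstimator_le (hM : M.FullRank) {U : Matrix (Fin p) (Fin K) ℝ}
    (hU : IsTopEigenvectors M.covX U) {n : ℕ} (hn : 0 < n) (X : Matrix (Fin n) (Fin p) ℝ)
    (y : Fin n → ℝ) {u τ : ℝ} (hτ : 0 ≤ τ)
    (hτ2 : τ ^ 2 = M.risk (U *ᵥ (Uᵀ *ᵥ M.bestLinear)))
    (hX : ∀ v, n / 5 * (v ⬝ᵥ v) ≤ (X *ᵥ M.whiten U v) ⬝ᵥ (X *ᵥ M.whiten U v))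
    (hy : ∀ s : ℝ, s = τ ∨ s = -τ ∨ s = 0 → ∀ k, ∀ r : Fin n → ℝ,
      r = X *ᵥ (U *ᵥ (Uᵀ *ᵥ M.bestLinear) + M.whiten U (s • Pi.single k 1)) - y →
      |r ⬝ᵥ r - n * (τ ^ 2 + s ^ 2)| ≤ n * (τ ^ 2 + s ^ 2) * u) :
    M.risk (pcrEstimator U X y) ≤ τ ^ 2 * (1 + 25 * K * u ^ 2) := by
  have hn' : (0 : ℝ) < n := by exact_mod_cast hn
  set γ := Uᵀ *ᵥ M.bestLinear with hγ
  set η : Fin n → ℝ := y - X *ᵥ (U *ᵥ γ) with hη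
  set D : Fin K → ℝ := fun k => √(ordEig M.covX ((k : ℕ) + 1)) with hD
  have hDpos : ∀ k, 0 < D k := fun k => Real.sqrt_pos.2 (M.ordEig_covX_pos hM k)
  set W : Matrix (Fin n) (Fin K) ℝ := X * U * Matrix.diagonal fun k => (D k)⁻¹ with hW
  have hWv : ∀ v, W *ᵥ v = X *ᵥ M.whiten U v := M.mul_mul_diagonal_mulVec X U
  -- correlation of the whitened features with the residuals
  have hcorr : ∀ k, (Wᵀ *ᵥ η) k ^ 2 ≤ n ^ 2 * τ ^ 2 * u ^ 2 := by
    intro k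
    set w : Fin n → ℝ := W *ᵥ Pi.single k 1 with hw
    have hk : (Wᵀ *ᵥ η) k = η ⬝ᵥ w := by
      rw [hw, dotProduct_mulVec_transpose]
      simp
    have hrss : ∀ s : ℝ, s = τ ∨ s = -τ ∨ s = 0 →
        |(η ⬝ᵥ η) - 2 * s * (η ⬝ᵥ w) + s ^ 2 * (w ⬝ᵥ w) - n * (τ ^ 2 + s ^ 2)|
          ≤ n * (τ ^ 2 + s ^ 2) * u := by
      intro s hs
      have h := hy s hs k _ rfl
      have e : X *ᵥ (U *ᵥ γ + M.whiten U (s • Pi.single k 1)) - y = s • w - η := by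
        rw [Matrix.mulVec_add, ← hWv, Matrix.mulVec_smul, ← hw, hη]
        abel
      rw [e] at h
      have e2 : (s • w - η) ⬝ᵥ (s • w - η)
          = (η ⬝ᵥ η) - 2 * s * (η ⬝ᵥ w) + s ^ 2 * (w ⬝ᵥ w) := by
        simp only [sub_dotProduct, dotProduct_sub, smul_dotProduct, dotProduct_smul, smul_eq_mul]
        rw [dotProduct_comm w η]
        ring
      rwa [e2] at h
    rw [hk]
    -- If `τ = 0`, polarization gives nothing, but the case `s = 0` already forces `η = 0`.
    rcases hτ.eq_or_lt with h0 | h0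
    · have h1 := hrss 0 (Or.inr (Or.inr rfl))
      have h2 : η ⬝ᵥ η = 0 := by
        rw [← h0] at h1
        simpa using h1
      rw [dotProduct_self_eq_zero.1 h2, zero_dotProduct, ← h0]
      simp
    · have h1 := abs_le.1 (hrss τ (Or.inl rfl))
      have h2 := abs_le.1 (hrss (-τ) (Or.inr (Or.inl rfl)))
      -- Subtracting the cases `s = τ` and `s = -τ` leaves `4τ (η ⬝ᵥ w)`, with error at most `2 ·
      -- 2nτ²u`.
      have h3 : |η ⬝ᵥ w| ≤ n * τ * u := by
        rw [abs_le]
        constructor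
        · refine le_of_mul_le_mul_left ?_ h0
          nlinarith [h1.1, h1.2, h2.1, h2.2]
        · refine le_of_mul_le_mul_left ?_ h0
          nlinarith [h1.1, h1.2, h2.1, h2.2]
      calc (η ⬝ᵥ w) ^ 2 = |η ⬝ᵥ w| ^ 2 := (sq_abs _).symm
        _ ≤ (n * τ * u) ^ 2 := pow_le_pow_left₀ (abs_nonneg _) h3 2
        _ = _ := by ring
  have hWη : (Wᵀ *ᵥ η) ⬝ᵥ (Wᵀ *ᵥ η) ≤ K * (n ^ 2 * τ ^ 2 * u ^ 2) := by
    rw [dotProduct_self_eq_sum_sq]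
    refine (Finset.sum_le_sum fun k _ => hcorr k).trans_eq ?_
    simp
  -- the estimation error in whitened coordinates
  set B := X * U with hB
  set γ' := pinv B *ᵥ y with hγ'
  set g : Fin K → ℝ := fun k => D k * (γ' - γ) k with hg
  have hWg : W *ᵥ g = B *ᵥ (γ' - γ) := by
    rw [hW, ← Matrix.mulVec_mulVec]
    congr 1
    funext k
    rw [Matrix.mulVec_diagonal, hg]
    field_simp [(hDpos k).ne']
  have hP := isMoorePenrose_pinv B
  have hyη : y = B *ᵥ γ + η := by
    rw [hη, hB, ← Matrix.mulVec_mulVec]; abel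
  have hBB : B *ᵥ (γ' - γ) = (B * pinv B) *ᵥ η := by
    rw [Matrix.mulVec_sub, hγ', hyη, Matrix.mulVec_mulVec, Matrix.mulVec_add, Matrix.mulVec_mulVec,
      hP.mul_mul_self]
    abel
  -- `W g` is the orthogonal projection `B B⁺ η`, so `‖W g‖² = η ⬝ᵥ W g`. Combined with `hX` and
  -- Cauchy–Schwarz this gives `(n/5) ‖g‖ ≤ ‖Wᵀ η‖`.
  have hproj : (W *ᵥ g) ⬝ᵥ (W *ᵥ g) = (Wᵀ *ᵥ η) ⬝ᵥ g := by
    rw [← dotProduct_mulVec_transpose, hWg, hBB, mulVec_dotProduct_mulVec, hP.symm_left,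
      ← Matrix.mul_assoc, hP.mul_mul_self]
  have hlow := hX g
  rw [← hWv, hproj] at hlow
  have hcs := dotProduct_sq_le (Wᵀ *ᵥ η) g
  have hg0 := dotProduct_self_nonneg' g
  have hgg : g ⬝ᵥ g ≤ 25 * K * τ ^ 2 * u ^ 2 := by
    rcases hg0.eq_or_lt with h0 | h0
    · rw [← h0]; positivity
    · have h1 : (n / 5 * (g ⬝ᵥ g)) ^ 2 ≤ K * (n ^ 2 * τ ^ 2 * u ^ 2) * (g ⬝ᵥ g) :=
        (pow_le_pow_left₀ (by positivity) hlow 2).trans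
          (hcs.trans (mul_le_mul_of_nonneg_right hWη hg0))
      have h2 : (n ^ 2 / 25 * (g ⬝ᵥ g)) * (g ⬝ᵥ g)
          ≤ (n ^ 2 / 25 * (25 * K * τ ^ 2 * u ^ 2)) * (g ⬝ᵥ g) := by
        calc _ = (n / 5 * (g ⬝ᵥ g)) ^ 2 := by ring
          _ ≤ _ := h1
          _ = _ := by ring
      exact le_of_mul_le_mul_left (le_of_mul_le_mul_right h2 h0) (by positivity)
  have hrisk : wNormSq M.covX (U *ᵥ (γ' - γ)) = g ⬝ᵥ g := by
    rw [M.wNormSq_covX_mulVec hU, dotProduct_self_eq_sum_sq]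
    refine Finset.sum_congr rfl fun k _ => ?_
    rw [hg, mul_pow, hD, Real.sq_sqrt (M.ordEig_covX_pos hM k).le]
  have hest : pcrEstimator U X y = U *ᵥ γ' := rfl
  rw [hest, M.risk_mulVec hM hU, ← hγ, ← hτ2, hrisk]
  linarith

/-! ### The sample -/

section Sample

variable {Ω' : Type*} [MeasurableSpace Ω'] {μ : Measure Ω'} {n : ℕ}
  {Zs : Fin n → Ω' → Fin K → ℝ} {Es : Fin n → Ω' → Fin p → ℝ} {εs : Fin n → Ω' → ℝ}

/-- The scalar `b` covers both uses: `b = 0` for the design, `b = 1` for residuals. -/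
theorem map_linear_eq_gaussianReal (hG : HasGaussianLaw (fun ω => (M.X ω, M.y ω)) P)
    (θ : Fin p → ℝ) (b : ℝ) :
    P.map (fun ω => M.X ω ⬝ᵥ θ - b * M.y ω)
      = gaussianReal 0 (∫ ω, (M.X ω ⬝ᵥ θ - b * M.y ω) ^ 2 ∂P).toNNReal := by
  let L : ((Fin p → ℝ) × ℝ) →L[ℝ] ℝ :=
    LinearMap.toContinuousLinearMap
      { toFun := fun q => q.1 ⬝ᵥ θ - b * q.2
        map_add' := fun q r => by simp only [Prod.fst_add, Prod.snd_add, add_dotProduct]; ring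
        map_smul' := fun c q => by
          simp only [Prod.smul_fst, Prod.smul_snd, smul_dotProduct, smul_eq_mul, RingHom.id_apply]
          ring }
  have hL : HasGaussianLaw (fun ω => M.X ω ⬝ᵥ θ - b * M.y ω) P := hG.map_fun L
  have hX := (M.memLp_X.dotProduct_const θ).integrable (by norm_num)
  have hZ := (M.memLp_Z.dotProduct_const M.β).integrable (by norm_num)
  have hε := M.memLp_ε.integrable (by norm_num)
  have hy : Integrable M.y P := hZ.add hε
  have hmean : ∫ ω, (M.X ω ⬝ᵥ θ - b * M.y ω) ∂P = 0 := by
    have hy0 : ∫ ω, M.y ω ∂P = 0 := by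
      unfold y
      rw [integral_add hZ hε, integral_dotProduct_eq_zero M.memLp_Z M.mean_Z, M.mean_ε, zero_add]
    rw [integral_sub hX (hy.const_mul b), integral_const_mul, hy0,
      integral_dotProduct_eq_zero M.memLp_X M.mean_X, mul_zero, sub_zero]
  rw [hL.map_eq_gaussianReal, hmean, variance_of_integral_eq_zero hL.aemeasurable hmean]

/-- The empirical second moment of a linear combination of features and response concentrates
around the population second moment. -/
theorem IsSample.measureReal_abs_sub_le (hS : M.IsSample μ Zs Es εs)
    (hG : HasGaussianLaw (fun ω => (M.X ω, M.y ω)) P) (θ : Fin p → ℝ) (b : ℝ) {v u : ℝ}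
    (hv : v = ∫ ω, (M.X ω ⬝ᵥ θ - b * M.y ω) ^ 2 ∂P) (hu0 : 0 ≤ u) (hu1 : u ≤ 1) :
    μ.real {ω | ∃ r, r = M.dataX (fun i => Zs i ω) (fun i => Es i ω) *ᵥ θ
        - b • M.dataY (fun i => Zs i ω) (fun i => εs i ω) ∧
      n * v * u < |r ⬝ᵥ r - n * v|} ≤ 2 * Real.exp (-(n * u ^ 2 / 8)) := by
  let φ : (Fin K → ℝ) × (Fin p → ℝ) × ℝ → ℝ :=
    fun q => (M.A *ᵥ q.1 + q.2.1) ⬝ᵥ θ - b * (q.1 ⬝ᵥ M.β + q.2.2)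
  have hφ : Measurable φ := by
    simp only [φ, dotProduct, Matrix.mulVec, Pi.add_apply]
    fun_prop
  let f : Fin n → Ω' → ℝ := fun i ω => φ (Zs i ω, Es i ω, εs i ω)
  have hind : iIndepFun f μ := hS.indep.comp (fun _ => φ) fun _ => hφ
  have hid : ∀ i, IdentDistrib (f i) (fun ω => M.X ω ⬝ᵥ θ - b * M.y ω) μ P :=
    fun i => (hS.identDistrib i).comp hφ
  have hv0 : 0 ≤ v := by rw [hv]; exact integral_nonneg fun ω => sq_nonneg _
  have h := measureReal_abs_sum_sq_sub_le hind (fun i => (hid i).aemeasurable_fst)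
    (fun i => (hid i).map_eq.trans (M.map_linear_eq_gaussianReal hG θ b)) hu0 hu1
  rw [← hv, Real.coe_toNNReal v hv0] at h
  convert h using 3
  ext ω
  simp only [exists_eq_left, dotProduct_self_eq_sum_sq]
  rfl

end Sample

end FactorModel

/-! ### Union bounds and the high-probability event. -/

/-- The grid has at most `(16K + 1)^K ≤ n^K` points, each failing with probability at most `2 exp
(-n/32)`; `n > 128 K log n` gives `n/32 ≥ (K + 1) log n`. -/
theorem card_cubeGrid_mul_exp_le {K n : ℕ} (hK : 1 ≤ K) (hn : 2 ≤ n) (h : 128 * K * Real.log n < n) :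
    ((cubeGrid K (8 * K)).card : ℝ) * (2 * Real.exp (-(n * (1 / 2) ^ 2 / 8))) ≤ 2 / n := by
  have hn' : (2 : ℝ) ≤ n := by exact_mod_cast hn
  have hK' : (1 : ℝ) ≤ K := by exact_mod_cast hK
  have hlog : 0.69 ≤ Real.log n :=
    (by linarith [Real.log_two_gt_d9] : (0.69 : ℝ) ≤ Real.log 2).trans
      (Real.log_le_log (by norm_num) hn')
  have hKn : 16 * (K : ℝ) + 1 ≤ n := by nlinarith
  have hcard : ((cubeGrid K (8 * K)).card : ℝ) ≤ Real.exp (K * Real.log n) := by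
    calc ((cubeGrid K (8 * K)).card : ℝ) ≤ ((2 * (8 * K) + 1 : ℕ) : ℝ) ^ K := by
          exact_mod_cast card_cubeGrid_le K (8 * K)
      _ ≤ (n : ℝ) ^ K := by
          refine pow_le_pow_left₀ (by positivity) ?_ K
          push_cast
          linarith
      _ = Real.exp (K * Real.log n) := by
          rw [Real.exp_nat_mul, Real.exp_log (by linarith)]
  calc _ ≤ Real.exp (K * Real.log n) * (2 * Real.exp (-(n * (1 / 2) ^ 2 / 8))) := by gcongr
    _ = 2 * Real.exp (K * Real.log n + -(n * (1 / 2) ^ 2 / 8)) := by rw [Real.exp_add]; ring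
    _ ≤ 2 * Real.exp (-Real.log n) := by
        gcongr
        nlinarith
    _ = 2 / n := by rw [Real.exp_neg, Real.exp_log (by linarith)]; rfl

namespace FactorModel

variable {Ω : Type*} [MeasurableSpace Ω] {P : Measure Ω} {p K : ℕ} (M : FactorModel P p K)
  [IsProbabilityMeasure P]

section Sample

variable {Ω' : Type*} [MeasurableSpace Ω'] {μ : Measure Ω'} {n : ℕ}
  {Zs : Fin n → Ω' → Fin K → ℝ} {Es : Fin n → Ω' → Fin p → ℝ} {εs : Fin n → Ω' → ℝ}

/-- With high probability, principal components regression is nearly as good as the projection of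
the best linear predictor onto the span of the principal components. -/
theorem IsSample.measureReal_pcrRisk_gt_le (hS : M.IsSample μ Zs Es εs)
    (hG : HasGaussianLaw (fun ω => (M.X ω, M.y ω)) P) (hM : M.FullRank)
    {U : Matrix (Fin p) (Fin K) ℝ} (hU : IsTopEigenvectors M.covX U) (hK : 1 ≤ K) (hn : 2 ≤ n)
    (h : 128 * K * Real.log n < n) :
    μ.real {ω | ¬ M.pcrRisk U Zs Es εs ω ≤
      M.risk (U *ᵥ (Uᵀ *ᵥ M.bestLinear)) * (1 + 400 * (K * Real.log n / n))} ≤ 8 / n := by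
  have : IsProbabilityMeasure μ := hS.indep.isProbabilityMeasure
  have hn' : (2 : ℝ) ≤ n := by exact_mod_cast hn
  have hK' : (1 : ℝ) ≤ K := by exact_mod_cast hK
  have hlog : 0 ≤ Real.log n := Real.log_nonneg (by linarith)
  set R := M.risk (U *ᵥ (Uᵀ *ᵥ M.bestLinear)) with hR
  have hR0 : 0 ≤ R := M.noiseVar_nonneg.trans (M.noiseVar_le_risk _)
  set τ := √R with hτ
  have hτ2 : τ ^ 2 = R := Real.sq_sqrt hR0
  -- Chosen so that `exp (-n u² / 8) = n⁻²`, small enough for `3K` residual events; then `25 K u² =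
  -- 400 K log n / n`.
  set u := √(16 * Real.log n / n) with hu
  have hu2 : u ^ 2 = 16 * Real.log n / n := Real.sq_sqrt (by positivity)
  have hu0 : 0 ≤ u := Real.sqrt_nonneg _
  have hu1 : u ≤ 1 := by
    refine Real.sqrt_le_one.2 ?_
    rw [div_le_one (by linarith)]
    nlinarith
  let badX : (Fin K → ℝ) → Set Ω' := fun v => {ω | ∃ r,
    r = M.dataX (fun i => Zs i ω) (fun i => Es i ω) *ᵥ M.whiten U v
      - (0 : ℝ) • M.dataY (fun i => Zs i ω) (fun i => εs i ω) ∧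
    n * (v ⬝ᵥ v) * (1 / 2) < |r ⬝ᵥ r - n * (v ⬝ᵥ v)|}
  let badY : ℝ × Fin K → Set Ω' := fun q => {ω | ∃ r,
    r = M.dataX (fun i => Zs i ω) (fun i => Es i ω) *ᵥ
        (U *ᵥ (Uᵀ *ᵥ M.bestLinear) + M.whiten U (q.1 • Pi.single q.2 1))
      - (1 : ℝ) • M.dataY (fun i => Zs i ω) (fun i => εs i ω) ∧
    n * (τ ^ 2 + q.1 ^ 2) * u < |r ⬝ᵥ r - n * (τ ^ 2 + q.1 ^ 2)|}
  let T : Finset (ℝ × Fin K) := ({τ, -τ, 0} : Finset ℝ) ×ˢ Finset.univ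
  have hX : ∀ v, μ.real (badX v) ≤ 2 * Real.exp (-(n * (1 / 2) ^ 2 / 8)) := by
    intro v
    refine hS.measureReal_abs_sub_le M hG _ 0 ?_ (by norm_num) (by norm_num)
    rw [← M.wNormSq_covX_whiten hM hU, wNormSq, covX,
      ← integral_dotProduct_mul_dotProduct M.memLp_X M.mean_X]
    exact integral_congr_ae (ae_of_all _ fun ω => by simp [sq])
  have hY : ∀ q, μ.real (badY q) ≤ 2 * (1 / (n : ℝ) ^ 2) := by
    intro q
    have h1 : Real.exp (-(n * u ^ 2 / 8)) = 1 / (n : ℝ) ^ 2 := by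
      rw [hu2, one_div, ← Real.exp_log (show (0 : ℝ) < (n : ℝ) ^ 2 by positivity), ← Real.exp_neg,
        Real.log_pow]
      congr 1
      push_cast
      field_simp
      ring
    rw [← h1]
    refine hS.measureReal_abs_sub_le M hG _ 1 ?_ hu0 hu1
    have h2 := M.risk_projection_add_whiten hM hU (q.1 • Pi.single q.2 1)
    have h3 : (q.1 • Pi.single q.2 1 : Fin K → ℝ) ⬝ᵥ (q.1 • Pi.single q.2 1) = q.1 ^ 2 := by
      simp [sq]
    rw [h3, ← hR, ← hτ2] at h2
    rw [← h2, risk]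
    simp only [one_mul]
  have hT : (T.card : ℝ) ≤ 3 * K := by
    have : T.card ≤ 3 * K := by
      rw [Finset.card_product, Finset.card_univ, Fintype.card_fin]
      exact Nat.mul_le_mul_right _ Finset.card_le_three
    exact_mod_cast this
  have hsub : {ω | ¬ M.pcrRisk U Zs Es εs ω ≤ R * (1 + 400 * (K * Real.log n / n))}
      ⊆ (⋃ v ∈ cubeGrid K (8 * K), badX v) ∪ ⋃ q ∈ T, badY q := by
    intro ω hω
    by_contra hgood
    apply hω
    simp only [Set.mem_union, Set.mem_iUnion, not_or, not_exists] at hgood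
    obtain ⟨gX, gY⟩ := hgood
    have e : R * (1 + 400 * (K * Real.log n / n)) = τ ^ 2 * (1 + 25 * K * u ^ 2) := by
      rw [hτ2, hu2]; ring
    rw [e]
    refine M.risk_pcrEstimator_le hM hU (by omega) _ _ (Real.sqrt_nonneg _) hτ2 ?_ ?_
    · set X := M.dataX (fun i => Zs i ω) (fun i => Es i ω)
      intro v
      rw [← M.mul_mul_diagonal_mulVec]
      refine le_mulVec_sq_of_grid hK rfl _ (by linarith) (fun v hv => ?_) v
      rw [M.mul_mul_diagonal_mulVec]
      by_contra hlt
      exact gX v hv ⟨X *ᵥ M.whiten U v, by rw [zero_smul, sub_zero], not_le.1 hlt⟩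
    · intro s hs k r hr
      by_contra hlt
      refine gY (s, k) ?_ ⟨r, by rw [one_smul]; exact hr, not_le.1 hlt⟩
      simp only [T, Finset.mem_product, Finset.mem_insert, Finset.mem_singleton, Finset.mem_univ,
        and_true]
      exact hs
  have hKn : (K : ℝ) ≤ n := by
    have : 0.69 ≤ Real.log n :=
      (by linarith [Real.log_two_gt_d9] : (0.69 : ℝ) ≤ Real.log 2).trans
        (Real.log_le_log (by norm_num) hn')
    nlinarith
  calc _ ≤ μ.real ((⋃ v ∈ cubeGrid K (8 * K), badX v) ∪ ⋃ q ∈ T, badY q) := measureReal_mono hsub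
    _ ≤ μ.real (⋃ v ∈ cubeGrid K (8 * K), badX v) + μ.real (⋃ q ∈ T, badY q) :=
        measureReal_union_le _ _
    _ ≤ ∑ v ∈ cubeGrid K (8 * K), μ.real (badX v) + ∑ q ∈ T, μ.real (badY q) :=
        add_le_add (measureReal_biUnion_finset_le _ _) (measureReal_biUnion_finset_le _ _)
    _ ≤ ∑ v ∈ cubeGrid K (8 * K), 2 * Real.exp (-(n * (1 / 2) ^ 2 / 8))
          + ∑ q ∈ T, 2 * (1 / (n : ℝ) ^ 2) :=
        add_le_add (Finset.sum_le_sum fun v _ => hX v) (Finset.sum_le_sum fun q _ => hY q)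
    _ = (cubeGrid K (8 * K)).card * (2 * Real.exp (-(n * (1 / 2) ^ 2 / 8)))
          + T.card * (2 * (1 / (n : ℝ) ^ 2)) := by
        simp only [Finset.sum_const, nsmul_eq_mul]
    -- The grid costs `2/n`; the residual events cost `6K/n² ≤ 6/n`.
    _ ≤ 2 / n + 3 * n * (2 * (1 / (n : ℝ) ^ 2)) := by
        gcongr
        · exact card_cubeGrid_mul_exp_le hK hn h
        · linarith
    _ = 8 / n := by field_simp; ring

end Sample

end FactorModel

/-! ### Assembly of the four bounds on a single event. -/

theorem mainTheorem5 :
    ∃ C c C' : ℝ, 0 < C ∧ 0 < c ∧ 0 < C' ∧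
      ∀ (n p K : ℕ), 1 ≤ K → n < p → C * K * Real.log n < n →
      ∀ {Ω : Type*} [MeasurableSpace Ω] (P : Measure Ω) [IsProbabilityMeasure P]
        (M : FactorModel P p K),
        HasGaussianLaw (fun ω => (M.X ω, M.y ω)) P → M.FullRank →
      ∀ (U : Matrix (Fin p) (Fin K) ℝ), IsTopEigenvectors M.covX U →
      ∀ {Ω' : Type*} [MeasurableSpace Ω'] (μ : Measure Ω') [IsProbabilityMeasure μ]
        (Zs : Fin n → Ω' → Fin K → ℝ) (Es : Fin n → Ω' → Fin p → ℝ) (εs : Fin n → Ω' → ℝ),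
        M.IsSample μ Zs Es εs →
        ENNReal.ofReal (1 - c / n) ≤ μ {ω |
          -- excess risk over the best linear predictor
          (M.pcrRisk U Zs Es εs ω - M.risk M.bestLinear ≤
            C' * (opNorm M.covE * ‖WithLp.toLp 2 M.bestLinear‖ ^ 2 * (p / n)
              + M.risk M.bestLinear * (K * Real.log n / n))) ∧
          -- excess risk over the oracle risk; here `M.snr⁻¹ = 0` if `Σ_E = 0`
          (M.pcrRisk U Zs Es εs ω - M.noiseVar ≤
            C' * ((1 + M.snr⁻¹) * opNorm M.covE * ‖WithLp.toLp 2 M.bestLinear‖ ^ 2 * (p / n)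
              + M.risk M.bestLinear * (K * Real.log n / n))) ∧
          -- noiseless features
          (M.covE = 0 →
            M.pcrRisk U Zs Es εs ω - M.noiseVar ≤
              C' * (M.noiseVar * (K * Real.log n / n))) ∧
          -- non-degenerate feature noise
          (0 < ordEig M.covE p →
            M.pcrRisk U Zs Es εs ω - M.noiseVar ≤
              C' * (condNumber M.covE * (wNormSq M.covZ M.β / M.snr) * (p / n)
                + M.noiseVar * (K * Real.log n / n)))} := by
  refine ⟨128, 8, 1000, by norm_num, by norm_num, by norm_num, ?_⟩
  intro n p K hK hnp hn Ω _ P _ M hG hM U hU Ω' _ μ _ Zs Es εs hS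
  rcases lt_or_ge n 2 with hn2 | hn2
  -- For `n = 0` the sample size condition reads `0 < 0`; for `n = 1` the probability bound is
  -- vacuous.
  · have h0 : (1 : ℝ) - 8 / n ≤ 0 := by
      interval_cases n
      · simp at hn
      · norm_num
    rw [ENNReal.ofReal_eq_zero.2 h0]
    exact zero_le
  have hn' : (2 : ℝ) ≤ n := by exact_mod_cast hn2
  set B := {ω | ¬ M.pcrRisk U Zs Es εs ω ≤
      M.risk (U *ᵥ (Uᵀ *ᵥ M.bestLinear)) * (1 + 400 * (K * Real.log n / n))} with hB
  have hμB : μ.real B ≤ 8 / n := hS.measureReal_pcrRisk_gt_le M hG hM hU hK hn2 hn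
  have hμBc : ENNReal.ofReal (1 - 8 / n) ≤ μ Bᶜ := by
    rw [ENNReal.ofReal_sub _ (by positivity), ENNReal.ofReal_one, tsub_le_iff_right,
      ← measure_univ (μ := μ), ← Set.compl_union_self B]
    refine (measure_union_le _ _).trans (add_le_add_right ?_ _)
    rw [← ofReal_measureReal]
    exact ENNReal.ofReal_le_ofReal hμB
  refine hμBc.trans (measure_mono fun ω hω => ?_)
  have hrisk : M.pcrRisk U Zs Es εs ω ≤
      M.risk (U *ᵥ (Uᵀ *ᵥ M.bestLinear)) * (1 + 400 * (K * Real.log n / n)) := not_not.1 hω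
  set Q := M.pcrRisk U Zs Es εs ω
  set L := K * Real.log n / n with hL
  have hL0 : 0 ≤ L := div_nonneg (mul_nonneg (by positivity) (Real.log_nonneg (by linarith)))
    (by positivity)
  have hL1 : L ≤ 1 / 128 := by
    rw [hL, div_le_iff₀ (by linarith)]
    linarith
  -- The factor `p / n` in the bounds enters only here: the bias terms are bounded without it, then
  -- enlarged.
  have hq : (1 : ℝ) ≤ p / n := by
    rw [one_le_div (by linarith)]
    exact_mod_cast hnp.le
  set q : ℝ := p / n
  have hproj := M.risk_projection_le hM hU
  have hA0 := dotProduct_self_nonneg' M.bestLinear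
  rw [norm_toLp_sq]
  set A := M.bestLinear ⬝ᵥ M.bestLinear
  set s := opNorm M.covE with hs
  have hs0 : 0 ≤ s := opNorm_nonneg _
  set R := M.risk M.bestLinear
  set σ := M.noiseVar
  have hσ0 : 0 ≤ σ := M.noiseVar_nonneg
  have hσR : σ ≤ R := M.noiseVar_le_risk _
  have hsA : 0 ≤ s * A := mul_nonneg hs0 hA0
  -- The coefficient of `s * A` is `1 + 400 L ≤ 1 + 400/128 < 5`.
  have hexc : Q - R ≤ 5 * (s * A) + 400 * (R * L) := by
    have h1 : Q ≤ (R + s * A) * (1 + 400 * L) :=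
      hrisk.trans (mul_le_mul_of_nonneg_right hproj (by positivity))
    nlinarith
  have hRL : 0 ≤ R * L := mul_nonneg (hσ0.trans hσR) hL0
  have hσL : 0 ≤ σ * L := mul_nonneg hσ0 hL0
  have horacle := M.risk_bestLinear_sub_noiseVar_le hM hK
  have hx0 : 0 ≤ M.snr⁻¹ := inv_nonneg.2 (M.snr_nonneg hM hK)
  have hsq : s * A ≤ s * A * q := le_mul_of_one_le_right hsA hq
  have hxsA : 0 ≤ M.snr⁻¹ * (s * A) := mul_nonneg hx0 hsA
  have hxsq : M.snr⁻¹ * (s * A) ≤ M.snr⁻¹ * (s * A) * q := le_mul_of_one_le_right hxsA hq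
  refine ⟨?_, ?_, ?_, ?_⟩
  · linarith
  · have e : (1 + M.snr⁻¹) * s * A * q = s * A * q + M.snr⁻¹ * (s * A) * q := by ring
    have e' : (1 + M.snr⁻¹) * s * A = s * A + M.snr⁻¹ * (s * A) := by ring
    rw [e]
    rw [← hs, e'] at horacle
    linarith
  · intro hE
    have hs00 : s = 0 := by rw [hs, hE, opNorm]; simp
    rw [← hs, hs00, mul_zero, zero_mul] at horacle
    rw [hs00, zero_mul] at hexc
    have : R = σ := by linarith
    rw [this] at hexc
    linarith
  · intro hE
    have hp : 1 ≤ p := by omega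
    have h1 := M.opNorm_mul_bestLinear_sq_le hM hK hE
    have h2 := M.risk_bestLinear_sub_noiseVar_le_snr hM hK
    have h3 := M.one_le_condNumber hp hE
    set t := wNormSq M.covZ M.β / M.snr
    have ht0 : 0 ≤ t := by linarith
    set κ := condNumber M.covE
    have h4 : t ≤ κ * t := le_mul_of_one_le_left ht0 h3
    have h5 : κ * t ≤ κ * t * q := le_mul_of_one_le_right (ht0.trans h4) hq
    -- Replaces `R(α*)` by the noise variance: the difference is at most `t`, and `t * L` is
    -- absorbed in the `κ * t * q` term.
    have h6 : R * L ≤ σ * L + t * (1 / 128) := by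
      have : R * L ≤ (σ + t) * L := mul_le_mul_of_nonneg_right (by linarith) hL0
      have h7 : t * L ≤ t * (1 / 128) := mul_le_mul_of_nonneg_left hL1 ht0
      linarith
    change Q - σ ≤ 1000 * (κ * t * q + σ * L)
    change s * A ≤ κ * t at h1
    change R - σ ≤ t at h2
    linarith
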